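/- **Setting.** Let $K_q$ be a local field of characteristic $p>0$ whose residue field has $q=p^c$ elements, with normalized absolute value $|\cdot|$; let $\mathcal D=\{|x|\le 1\}$, let $dx$ be the Haar measure with $|\mathcal D|=1$, and let $\mathfrak p$ be a prime element ($|\mathfrak p|=q^{-1}$). Let $1=e_0,e_1,\dots,e_{c-1}$ be units in the field of constants $GF(q)\subset K_q$ (that is, $e_i^q=e_i$) whose classes form a basis of $\mathcal D/\mathfrak p\mathcal D$ over $GF(p)$. Let $\chi$ be the continuous unitary character of $K_q$, trivial on $\mathcal D$, with $\chi(e_i\mathfrak p^{-j})=e^{2\pi i/p}$ if $i=0,\ j=1$ (where $i$ in the exponent is the imaginary unit) and $\chi(e_i\mathfrak p^{-j})=1$ for all other $0\le i\le c-1$, $j\in\mathbb Z$. For $n=u_0+u_1p+\dots+u_{c-1}p^{c-1}<q$ with $0\le u_i<p$ put $\lambda(n)=(u_0+u_1e_1+\dots+u_{c-1}e_{c-1})\mathfrak p^{-1}$, and for $n=v_0+v_1q+\dots+v_tq^t$ with $0\le v_i<q$ put $\lambda(n)=\lambda(v_0)+\mathfrak p^{-1}\lambda(v_1)+\dots+\mathfrak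 p^{-t}\lambda(v_t)$. Write $\chi_k(\xi)=\chi(\lambda(k)\xi)$. For $\mathfrak s\in\mathbb R$ let $H^{\mathfrak s}(K_q)$ be the space of tempered distributions $u$ on $K_q$ whose Fourier transform $\hat u$ (for functions, $\hat u(\xi)=\int u(x)\chi(-\xi x)\,dx$) is a function with $\int(1+|\xi|^2)^{\mathfrak s}|\hat u(\xi)|^2d\xi<\infty$, with inner product $\langle u,v\rangle_{H^{\mathfrak s}(K_q)}=\int(1+|\xi|^2)^{\mathfrak s}\hat u(\xi)\overline{\hat v(\xi)}\,d\xi$. For all $j\in\mathbb Z$ and $0\le r\le q-1$ let $(\alpha^{(j)}_{k,r})_{k\ge 0}\in\ell^2(\mathbb N_0)$, and let $m^{(j)}_r\in L^2(\mathcal D)$ be functions on $K_q$ with $m_r^{(j)}(\xi+\lambda(k))=m_r^{(j)}(\xi)$ for all $k\in\mathbb N_0$ and $m^{(j)}_r=\sum_{k}\alpha^{(j)}_{k,r}\overline{\chi_k}$ in $L^2(\mathcal D)$, such that the matrix $\bigl(m^{(j)}_r(\mathfrak p\xi+\mathfrak p\lambda(t))\bigr)_{r,t=0}^{q-1}$ is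 unitary for a.e. $\xi\in\mathcal D$. Let $\varphi^{(j)}\in H^{\mathfrak s}(K_q)$, $j\in\mathbb Z$, be scaling functions: for each $j$ the system $q^{j/2}\varphi^{(j)}(\mathfrak p^{-j}\cdot-\lambda(k))$, $k\in\mathbb N_0$, is orthonormal in $H^{\mathfrak s}(K_q)$, and $\hat\varphi^{(j)}(\xi)=m_0^{(j+1)}(\mathfrak p\xi)\,\hat\varphi^{(j+1)}(\mathfrak p\xi)$ for a.e. $\xi$. Define the wavelet packets by $w^{(j)}_0=\varphi^{(j)}$ and, for $n=r+q\ell\ge1$ with $0\le r\le q-1$ and $\ell\in\mathbb N_0$, $$w^{(j)}_{n}=q\sum_{k\ge0}\alpha^{(j+1)}_{k,r}\,w^{(j+1)}_{\ell}(\mathfrak p^{-1}\cdot-\lambda(k)),$$ and put $w^{(j)}_{j,k,n}=q^{j/2}w^{(j)}_n(\mathfrak p^{-j}\cdot-\lambda(k))$. **Theorem (orthonormality at the $j$-th level).** The series above converge in the space of tempered distributions (and the same identity holds for $n=0$), all $w^{(j)}_{j,k,n}$ belong to $H^{\mathfrak s}(K_q)$, and for all $j\in\mathbb Z$ and $k,l,m,n\in\mathbb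 N_0$ $$\bigl\langle w^{(j)}_{j,k,n},w^{(j)}_{j,l,m}\bigr\rangle_{H^{\mathfrak s}(K_q)}=\delta_{\lfloor n/q\rfloor,\lfloor m/q\rfloor}\,\delta_{\mu_1,\eta_1}\,\delta_{k,l},$$ where $\mu_1,\eta_1\in\{0,\dots,q-1\}$ are the last base-$q$ digits of $n$ and $m$, i.e. $\mu_1\equiv n$ and $\eta_1\equiv m \pmod q$. -/

import Mathlib

open MeasureTheory Filter Topology ComplexConjugate

noncomputable section

namespace LocalFieldWavelet

section General

variable (K : Type*) [NontriviallyNormedField K] [LocallyCompactSpace K]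

/-- The closed unit ball (the ring of integers `D`), as a compact set with non-empty interior. -/
def unitBall : TopologicalSpace.PositiveCompacts K where
  carrier := Metric.closedBall (0 : K) 1
  isCompact' := by
    have : ProperSpace K := ProperSpace.of_locallyCompactSpace K
    exact isCompact_closedBall _ _
  interior_nonempty' :=
    ⟨0, mem_interior.2 ⟨_, Metric.ball_subset_closedBall, Metric.isOpen_ball, by simp⟩⟩

/-- The Haar measure of the additive group of `K`, normalized by `μ(D) = 1`. -/
def haar [MeasurableSpace K] [BorelSpace K] : Measure K :=
  Measure.addHaarMeasure (unitBall K)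

instance [MeasurableSpace K] [BorelSpace K] : (haar K).IsAddHaarMeasure := by
  unfold haar; infer_instance

/-- The space `S(K)` of test functions (the Schwartz, or Schwartz–Bruhat, space of a local field):
locally constant, compactly supported functions `K → ℂ`. -/
def TestFun : Submodule ℂ (K → ℂ) where
  carrier := {f | IsLocallyConstant f ∧ HasCompactSupport f}
  zero_mem' := ⟨IsLocallyConstant.const 0, HasCompactSupport.zero⟩
  add_mem' := fun hf hg => ⟨hf.1.add hg.1, hf.2.add hg.2⟩
  smul_mem' := fun c _ hf => ⟨hf.1.comp (fun z => c • z), hf.2.smul_left (f := fun _ => c)⟩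

/-- The space `S'(K)` of (tempered) distributions. The space `S(K)` is the increasing union of the
finite dimensional spaces of functions that are supported in one fixed ball and constant on the
balls of one fixed radius, with the inductive limit topology, so that every linear functional
on it is continuous. -/
abbrev TemperedDistrib : Type _ := TestFun K →ₗ[ℂ] ℂ

variable {K}

/-- The substitution `f ↦ f(a⁻¹(· + b))` on test functions. -/
def substTest (a : Kˣ) (b : K) : TestFun K →ₗ[ℂ] TestFun K where
  toFun f := ⟨fun x => f.1 ((a⁻¹ : Kˣ) * (x + b)), by
    let h : K ≃ₜ K := (Homeomorph.addRight b).trans (Homeomorph.mulLeft₀ ((a⁻¹ : Kˣ) : K) (by simp))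
    exact ⟨f.2.1.comp_continuous h.continuous, f.2.2.comp_homeomorph h⟩⟩
  map_add' _ _ := rfl
  map_smul' _ _ := rfl

/-- The distribution `u(a · - b)`, for `a ≠ 0`. It extends the operation on functions:
`∫ u(a x - b) f(x) dx = |a|⁻¹ ∫ u(y) f(a⁻¹(y + b)) dy`. Here the absolute value of `K` has to be
the normalized one, `d(a x) = |a| dx`. -/
def affine (u : TemperedDistrib K) (a : Kˣ) (b : K) : TemperedDistrib K :=
  ((‖(a : K)‖⁻¹ : ℝ) : ℂ) • (u ∘ₗ substTest a b)

/-- The series `∑ k, u k` converges to `v` in `S'(K)`, that is, on every test function. -/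
def HasDistSum (u : ℕ → TemperedDistrib K) (v : TemperedDistrib K) : Prop :=
  ∀ f : TestFun K, HasSum (fun k => u k f) (v f)

open Classical in
/-- The sum of a series of distributions (`0` if the series does not converge). -/
def distSum (u : ℕ → TemperedDistrib K) : TemperedDistrib K :=
  if h : ∃ v, HasDistSum u v then h.choose else 0

theorem TestFun.exists_uniform (f : TestFun K) :
    ∃ δ > 0, ∀ x h : K, ‖h‖ < δ → f.1 (x + h) = f.1 x := by
  have : ProperSpace K := ProperSpace.of_locallyCompactSpace K
  obtain ⟨hl, hc⟩ := f.2
  have hopen : ∀ c : ℂ, IsOpen (f.1 ⁻¹' {c}) := fun c => hl.isOpen_fiber c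
  obtain ⟨δ, hδ, H⟩ := lebesgue_number_lemma_of_metric hc.isCompact hopen
    (fun x _ => Set.mem_iUnion.2 ⟨f.1 x, rfl⟩)
  have key : ∀ x ∈ tsupport f.1, ∀ y, dist y x < δ → f.1 y = f.1 x := by
    intro x hx y hy
    obtain ⟨c, hcc⟩ := H x hx
    have h1 : f.1 x = c := hcc (Metric.mem_ball_self hδ)
    have h2 : f.1 y = c := hcc hy
    rw [h1, h2]
  refine ⟨δ, hδ, fun x h hh => ?_⟩
  have hd : dist (x + h) x < δ := by simpa [dist_eq_norm] using hh
  by_cases hx : x ∈ tsupport f.1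
  · exact key x hx _ hd
  · by_cases hy : x + h ∈ tsupport f.1
    · exact (key _ hy x (by rwa [dist_comm])).symm
    · rw [image_eq_zero_of_notMem_tsupport hx, image_eq_zero_of_notMem_tsupport hy]

theorem TestFun.integrable [MeasurableSpace K] [BorelSpace K] (f : TestFun K) :
    Integrable f.1 (haar K) :=
  f.2.1.continuous.integrable_of_hasCompactSupport f.2.2

end General

/-- A local field `K` of characteristic `p > 0` with residue field of `q = p ^ c` elements and
normalized absolute value, together with the usual choices: a prime element `𝔭`, elements
`1 = e₀, …, e_{c-1}` which give the digits, and a basic character `χ`. -/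
structure LocalFieldData (K : Type*) [NontriviallyNormedField K] [IsUltrametricDist K]
    [LocallyCompactSpace K] where
  /-- the characteristic -/
  p : ℕ
  /-- the degree of the residue field over its prime field -/
  c : ℕ
  p_prime : p.Prime
  c_pos : 0 < c
  char_p : CharP K p
  /-- the prime element `𝔭`, a generator of the maximal ideal `P = {|x| < 1}` -/
  ϖ : K
  norm_ϖ : ‖ϖ‖ = ((p ^ c : ℕ) : ℝ)⁻¹
  norm_le_ϖ : ∀ x : K, ‖x‖ < 1 → ‖x‖ ≤ ‖ϖ‖
  /-- the units `e₀, …, e_{c-1}` -/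
  e : Fin c → K
  norm_e : ∀ i, ‖e i‖ = 1
  e_zero : e ⟨0, c_pos⟩ = 1
  /-- the `e i` lie in the field of constants, the copy of `GF(q)` inside `K` -/
  e_pow : ∀ i, e i ^ (p ^ c) = e i
  /-- the classes of the `e i` are a basis of `D / P` over `GF(p)`; so `D / P` has `p ^ c`
  elements -/
  e_basis : ∀ x : K, ‖x‖ ≤ 1 → ∃! u : Fin c → Fin p, ‖x - ∑ i, ((u i : ℕ) : K) * e i‖ < 1
  /-- the unitary character of the additive group of `K` -/
  χ : AddChar K Circle
  χ_cont : Continuous χ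
  χ_trivial : ∀ x : K, ‖x‖ ≤ 1 → χ x = 1
  χ_apply : ∀ (i : Fin c) (j : ℤ), (χ (e i * ϖ ^ (-j)) : ℂ) =
    if (i : ℕ) = 0 ∧ j = 1 then Complex.exp (2 * Real.pi * Complex.I / p) else 1

namespace LocalFieldData

variable {K : Type*} [NontriviallyNormedField K] [IsUltrametricDist K] [LocallyCompactSpace K]
  (F : LocalFieldData K)

/-- The number of elements of the residue field. -/
def q : ℕ := F.p ^ F.c

theorem one_lt_q : 1 < F.q := Nat.one_lt_pow F.c_pos.ne' F.p_prime.one_lt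

theorem ϖ_ne_zero : F.ϖ ≠ 0 := by
  have h := F.norm_ϖ
  intro h0
  rw [h0, norm_zero] at h
  have : ((F.p ^ F.c : ℕ) : ℝ) ≠ 0 := by exact_mod_cast (pow_pos F.p_prime.pos _).ne'
  exact (inv_ne_zero this) h.symm

/-- `𝔭` as an element of the multiplicative group of `K`. -/
def ϖu : Kˣ := Units.mk0 F.ϖ F.ϖ_ne_zero

/-- `λ(n) = (u₀ + u₁ e₁ + ⋯ + u_{c-1} e_{c-1}) 𝔭⁻¹` for `n = u₀ + u₁ p + ⋯ + u_{c-1} p ^ (c-1)`,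
`0 ≤ n < q`. -/
def lamDigit (n : ℕ) : K := (∑ i : Fin F.c, ((n / F.p ^ (i : ℕ) % F.p : ℕ) : K) * F.e i) * F.ϖ⁻¹

/-- `λ(n) = λ(v₀) + 𝔭⁻¹ λ(v₁) + ⋯ + 𝔭⁻ˢ λ(v_s)` for `n = v₀ + v₁ q + ⋯ + v_s q ^ s`, `0 ≤ v_i < q`.
As `n < q ^ (n + 1)`, no digit is lost. -/
def lam (n : ℕ) : K :=
  ∑ i ∈ Finset.range (n + 1), F.ϖ⁻¹ ^ i * F.lamDigit (n / F.q ^ i % F.q)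

/-- The last digit `n mod q` of `n` to the base `q`. -/
def digit (n : ℕ) : Fin F.q := ⟨n % F.q, Nat.mod_lt _ (zero_lt_one.trans F.one_lt_q)⟩

/-- The digit `0`. -/
def zeroDigit : Fin F.q := ⟨0, zero_lt_one.trans F.one_lt_q⟩

theorem χ_inv_ϖ : F.χ (F.ϖ⁻¹) ≠ 1 := by
  intro h
  have h1 := F.χ_apply ⟨0, F.c_pos⟩ 1
  rw [F.e_zero, one_mul, zpow_neg_one, h] at h1
  simp only [Circle.coe_one, and_self, if_true] at h1
  have hp := F.p_prime
  have := (Complex.isPrimitiveRoot_exp F.p hp.ne_zero).pow_eq_one_iff_dvd 1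
  rw [pow_one] at this
  exact hp.one_lt.ne' (Nat.dvd_one.1 (this.1 h1.symm))

variable [MeasurableSpace K] [BorelSpace K]

/-- The Fourier transform of a test function is a test function. -/
theorem fourier_mem (f : TestFun K) :
    Fourier.fourierIntegral F.χ (haar K) f.1 ∈ TestFun K := by
  have : ProperSpace K := ProperSpace.of_locallyCompactSpace K
  constructor
  · obtain ⟨R, hR⟩ := f.2.2.isCompact.isBounded.subset_closedBall (0 : K)
    rw [IsLocallyConstant.iff_eventually_eq]
    intro ξ
    have hpos : 0 < (|R| + 1)⁻¹ := by positivity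
    filter_upwards [Metric.ball_mem_nhds ξ hpos] with η hη
    rw [Fourier.fourierIntegral_def, Fourier.fourierIntegral_def]
    refine integral_congr_ae (Eventually.of_forall fun x => ?_)
    by_cases hx : x ∈ tsupport f.1
    · have hxR : ‖x‖ ≤ |R| + 1 := by
        have := hR hx
        rw [mem_closedBall_zero_iff] at this
        linarith [le_abs_self R]
      have h1 : F.χ (-(x * (η - ξ))) = 1 := by
        apply F.χ_trivial
        rw [norm_neg, norm_mul]
        rw [Metric.mem_ball, dist_eq_norm] at hη
        calc ‖x‖ * ‖η - ξ‖ ≤ (|R| + 1) * (|R| + 1)⁻¹ := by gcongr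
          _ = 1 := mul_inv_cancel₀ (by positivity)
      have h2 : -(x * η) = -(x * (η - ξ)) + -(x * ξ) := by ring
      change F.χ (-(x * η)) • f.1 x = F.χ (-(x * ξ)) • f.1 x
      rw [h2, AddChar.map_add_eq_mul, h1, one_mul]
    · change F.χ (-(x * η)) • f.1 x = F.χ (-(x * ξ)) • f.1 x
      rw [image_eq_zero_of_notMem_tsupport hx, smul_zero, smul_zero]
  · obtain ⟨δ, hδ, H⟩ := TestFun.exists_uniform f
    have hinv : ∀ h : K, ‖h‖ < δ → ∀ ξ, Fourier.fourierIntegral F.χ (haar K) f.1 ξ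
        = F.χ (h * ξ) • Fourier.fourierIntegral F.χ (haar K) f.1 ξ := by
      intro h hh ξ
      have := congrFun (Fourier.fourierIntegral_comp_add_right F.χ (haar K) f.1 h) ξ
      rw [← this]
      congr 1
      funext x
      exact (H x h hh).symm
    refine HasCompactSupport.intro (isCompact_closedBall (0 : K) (‖F.ϖ⁻¹‖ / δ)) fun ξ hξ => ?_
    rw [mem_closedBall_zero_iff, not_le] at hξ
    have hξ0 : ξ ≠ 0 := by
      rintro rfl
      rw [norm_zero] at hξ
      exact absurd hξ (not_lt.2 (by positivity))
    have hn : ‖F.ϖ⁻¹ / ξ‖ < δ := by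
      rw [norm_div, div_lt_iff₀ (norm_pos_iff.2 hξ0)]
      rw [div_lt_iff₀ hδ] at hξ
      linarith
    have h1 := hinv _ hn ξ
    rw [div_mul_cancel₀ _ hξ0] at h1
    by_contra h0
    apply F.χ_inv_ϖ
    have h2 : ((F.χ F.ϖ⁻¹ : ℂ) - 1) * Fourier.fourierIntegral F.χ (haar K) f.1 ξ = 0 := by
      rw [sub_mul, one_mul, sub_eq_zero]
      exact h1.symm
    rcases mul_eq_zero.1 h2 with h3 | h3
    · exact Circle.ext (by simpa using sub_eq_zero.1 h3)
    · exact absurd h3 h0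

/-- The Fourier transform `f̂(ξ) = ∫ f(x) χ(-ξ x) dx` on test functions. -/
def fourierTest : TestFun K →ₗ[ℂ] TestFun K where
  toFun f := ⟨Fourier.fourierIntegral F.χ (haar K) f.1, F.fourier_mem f⟩
  map_add' f g := by
    ext ξ
    have hi : ∀ h : TestFun K, Integrable (fun x => F.χ (-(x * ξ)) • h.1 x) (haar K) := fun h =>
      Continuous.integrable_of_hasCompactSupport
        (((F.χ_cont.comp (by fun_prop)).smul h.2.1.continuous)) (h.2.2.smul_left)
    change ∫ x, F.χ (-(x * ξ)) • (f.1 x + g.1 x) ∂(haar K) = _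
    simp only [smul_add]
    exact integral_add (hi f) (hi g)
  map_smul' r f := by
    ext ξ
    exact congrFun (Fourier.fourierIntegral_const_smul F.χ (haar K) f.1 r) ξ

/-- The Fourier transform of a distribution, `⟨û, f⟩ = ⟨u, f̂⟩`. -/
def fourierDistrib (u : TemperedDistrib K) : TemperedDistrib K := u ∘ₗ F.fourierTest

/-- `û` is (given by) the locally integrable function `g`. -/
def HasFourierFun (u : TemperedDistrib K) (g : K → ℂ) : Prop :=
  LocallyIntegrable g (haar K) ∧ ∀ f : TestFun K, F.fourierDistrib u f = ∫ ξ, g ξ * f.1 ξ ∂(haar K)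

open Classical in
/-- The function `û`, for a distribution `u` whose Fourier transform is a locally integrable
function; it is unique up to null sets. -/
def fourierFun (u : TemperedDistrib K) : K → ℂ :=
  if h : ∃ g, F.HasFourierFun u g then h.choose else 0

/-- `u` belongs to the Sobolev space `Hˢ(K)`: the Fourier transform of `u` is a function with
`∫ (1 + |ξ|²)ˢ |û(ξ)|² dξ < ∞`. -/
def MemSobolev (s : ℝ) (u : TemperedDistrib K) : Prop :=
  (∃ g, F.HasFourierFun u g) ∧
    Integrable (fun ξ => (1 + ‖ξ‖ ^ 2) ^ s * ‖F.fourierFun u ξ‖ ^ 2) (haar K)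

/-- The inner product `∫ (1 + |ξ|²)ˢ û(ξ) conj (v̂(ξ)) dξ` of `Hˢ(K)`. -/
def sobolevInner (s : ℝ) (u v : TemperedDistrib K) : ℂ :=
  ∫ ξ, (((1 + ‖ξ‖ ^ 2) ^ s : ℝ) : ℂ) * (F.fourierFun u ξ * conj (F.fourierFun v ξ)) ∂(haar K)


/-- The scaled and translated distribution `q ^ (j/2) u(𝔭⁻ʲ · - λ(k))`. -/
def scaled (u : TemperedDistrib K) (j : ℤ) (k : ℕ) : TemperedDistrib K :=
  (((F.q : ℝ) ^ ((j : ℝ) / 2) : ℝ) : ℂ) • affine u (F.ϖu ^ (-j)) (F.lam k)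

/-- The terms of the series `q ∑ₖ αₖ u(𝔭⁻¹ · - λ(k))`. -/
def splitTerm (a : ℕ → ℂ) (u : TemperedDistrib K) (k : ℕ) : TemperedDistrib K :=
  ((F.q : ℂ) * a k) • affine u (F.ϖu⁻¹) (F.lam k)

/-- The wavelet packets `wₙ⁽ʲ⁾` (`F.packet φ α n j`) of the scaling functions `φ⁽ʲ⁾`:
`w₀⁽ʲ⁾ = φ⁽ʲ⁾` and
`wₙ⁽ʲ⁾ = q ∑ₖ α⁽ʲ⁺¹⁾_{k,r} w_ℓ⁽ʲ⁺¹⁾(𝔭⁻¹ · - λ(k))` for `n = r + q ℓ ≥ 1`, `0 ≤ r < q`.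
The coefficient `α⁽ʲ⁾_{k,r}` is `α j r k`. -/
def packet (φ : ℤ → TemperedDistrib K) (α : ℤ → Fin F.q → ℕ → ℂ) (n : ℕ) (j : ℤ) : TemperedDistrib K :=
  if h : n = 0 then φ j
  else distSum (F.splitTerm (α (j + 1) (F.digit n)) (packet φ α (n / F.q) (j + 1)))
termination_by n
decreasing_by exact Nat.div_lt_self (Nat.pos_of_ne_zero h) F.one_lt_q

/-- The functions `m_r⁽ʲ⁾`, `0 ≤ r < q`, are filters with coefficients `α⁽ʲ⁾_{k,r}`:
square summable coefficients, `m_r⁽ʲ⁾` integral-periodic and equal to `∑ₖ α⁽ʲ⁾_{k,r} conj χₖ` in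
`L²(D)`, where `χₖ(ξ) = χ(λ(k) ξ)`, and the matrices `(m_r⁽ʲ⁾(𝔭ξ + 𝔭λ(t)))_{r,t}` unitary for
almost every `ξ` in `D`. -/
structure IsFilterBank (α : ℤ → Fin F.q → ℕ → ℂ) (m : ℤ → Fin F.q → K → ℂ) : Prop where
  coeff : ∀ j r, Summable fun k => ‖α j r k‖ ^ 2
  memLp : ∀ j r, MemLp (m j r) 2 ((haar K).restrict (Metric.closedBall 0 1))
  periodic : ∀ j r (k : ℕ) (ξ : K), m j r (ξ + F.lam k) = m j r ξ
  series : ∀ j r, Tendsto (fun N : ℕ => eLpNorm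
      (fun ξ => m j r ξ - ∑ k ∈ Finset.range N, α j r k * conj (F.χ (F.lam k * ξ) : ℂ)) 2
      ((haar K).restrict (Metric.closedBall 0 1))) atTop (𝓝 0)
  unitary : ∀ j, ∀ᵐ ξ ∂((haar K).restrict (Metric.closedBall 0 1)),
    (Matrix.of fun r t : Fin F.q => m j r (F.ϖ * ξ + F.ϖ * F.lam t)) ∈
      Matrix.unitaryGroup (Fin F.q) ℂ

/-- `φ⁽ʲ⁾`, `j ∈ ℤ`, are level-dependent scaling functions in `Hˢ(K)` with low-pass filters
`m₀⁽ʲ⁾`: for every `j` the system `q ^ (j/2) φ⁽ʲ⁾(𝔭⁻ʲ · - λ(k))`, `k ≥ 0`, is orthonormal in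
`Hˢ(K)`, and `φ̂⁽ʲ⁾(ξ) = m₀⁽ʲ⁺¹⁾(𝔭ξ) φ̂⁽ʲ⁺¹⁾(𝔭ξ)` almost everywhere. -/
structure IsScalingSystem (s : ℝ) (φ : ℤ → TemperedDistrib K) (m₀ : ℤ → K → ℂ) : Prop where
  mem : ∀ j, F.MemSobolev s (φ j)
  orthonormal : ∀ j (k l : ℕ), F.sobolevInner s (F.scaled (φ j) j k) (F.scaled (φ j) j l) =
    if k = l then 1 else 0
  refinement : ∀ j, ∀ᵐ ξ ∂(haar K),
    F.fourierFun (φ j) ξ = m₀ (j + 1) (F.ϖ * ξ) * F.fourierFun (φ (j + 1)) (F.ϖ * ξ)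

end LocalFieldData

end LocalFieldWavelet

end

open MeasureTheory Filter Topology ComplexConjugate

noncomputable section

set_option linter.unusedSectionVars false

namespace LocalFieldWavelet

namespace LocalFieldData

/-! ### The points λ(n) as coset representatives of K/D, and the basic character on them. -/

section Digits

/-! On the Fourier side the splitting formula for n = r + qℓ reads ŵₙ⁽ʲ⁾(ξ) = m_r⁽ʲ⁺¹⁾(𝔭ξ)
ŵ_ℓ⁽ʲ⁺¹⁾(𝔭ξ). With η = 𝔭ʲξ, the inner product of two scaled translates becomes the integral of
χ((λ(l) − λ(k))η) against the density (1 + |𝔭⁻ʲη|²)ˢ ĝ(η) conj ĥ(η) (`sobolevInner_scaled`).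

The points λ(k) represent the cosets of D exactly once (`exists_lam`, `lam_injective`), and
χ(λ(k)λ(l)) = 1 (`χ_lam_mul_lam`). The integral over K therefore folds to an integral over D of a
character times the periodization of the density. The characters χₖ are orthonormal on D and
separate integrable functions there, so orthonormality of the translates means that the
periodization is 1 almost everywhere (`hasPeriodization_of_orthonormal`).

A unitary filter bank carries periodizations from level j + 1 to level j
(`HasPeriodization.filter`): the sum over λ(n) splits by the last digit t of n, the filters are
constant on each part by periodicity, and unitarity turns the sum over t into δ_{r,r'}. Removing
digits one at a time gives the periodization δ_{n,n'} for any two packets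
(`hasPeriodization_packet`).

The recursion makes sense because a packet with periodization 1 is locally square integrable on the
Fourier side. The L²(D) series of the filter can then be integrated term by term against test
functions (`hasDistSum_splitTerm`), so convergence and normalization are proved together by
induction on n. -/

theorem norm_sub_le_one {E : Type*} [SeminormedAddGroup E] [IsUltrametricDist E] {x y : E}
    (hx : ‖x‖ ≤ 1) (hy : ‖y‖ ≤ 1) : ‖x - y‖ ≤ 1 := by
  rw [sub_eq_add_neg]
  exact (IsUltrametricDist.norm_add_le_max _ _).trans (max_le hx (by rwa [norm_neg]))

variable {K : Type*} [NontriviallyNormedField K] [IsUltrametricDist K] [LocallyCompactSpace K]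
  (F : LocalFieldData K)

theorem q_pos : 0 < F.q := zero_lt_one.trans F.one_lt_q

theorem q_cast_pos : (0 : ℝ) < F.q := by exact_mod_cast F.q_pos

theorem norm_ϖ_eq : ‖F.ϖ‖ = (F.q : ℝ)⁻¹ := F.norm_ϖ

theorem norm_inv_ϖ : ‖F.ϖ⁻¹‖ = F.q := by rw [norm_inv, norm_ϖ_eq, inv_inv]

theorem norm_ϖ_pos : 0 < ‖F.ϖ‖ := norm_pos_iff.2 F.ϖ_ne_zero

theorem norm_ϖ_lt_one : ‖F.ϖ‖ < 1 := by
  rw [norm_ϖ_eq]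
  exact inv_lt_one_of_one_lt₀ (by exact_mod_cast F.one_lt_q)

/-- The representative of the residue class with number `n`, so that `λ(n) = 𝔭⁻¹ res(n)`
for `n < q`. -/
def res (n : ℕ) : K := ∑ i : Fin F.c, ((n / F.p ^ (i : ℕ) % F.p : ℕ) : K) * F.e i

theorem lamDigit_eq (n : ℕ) : F.lamDigit n = F.res n * F.ϖ⁻¹ := rfl

theorem norm_res_le (n : ℕ) : ‖F.res n‖ ≤ 1 := by
  refine IsUltrametricDist.norm_sum_le_of_forall_le_of_nonneg zero_le_one fun i _ => ?_
  rw [norm_mul, F.norm_e, mul_one]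
  exact IsUltrametricDist.norm_natCast_le_one K _

theorem res_finFunctionFinEquiv (u : Fin F.c → Fin F.p) :
    F.res (finFunctionFinEquiv u) = ∑ i, ((u i : ℕ) : K) * F.e i := by
  refine Finset.sum_congr rfl fun i _ => ?_
  rw [← finFunctionFinEquiv_symm_apply_val, Equiv.symm_apply_apply]

theorem exists_res (x : K) (hx : ‖x‖ ≤ 1) : ∃ n < F.q, ‖x - F.res n‖ < 1 := by
  obtain ⟨u, hu, -⟩ := F.e_basis x hx
  refine ⟨finFunctionFinEquiv u, (finFunctionFinEquiv u).2, ?_⟩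
  rwa [res_finFunctionFinEquiv]

theorem res_injective {a b : ℕ} (ha : a < F.q) (hb : b < F.q) (h : ‖F.res a - F.res b‖ < 1) :
    a = b := by
  obtain ⟨u, -, hu⟩ := F.e_basis (F.res a) (F.norm_res_le a)
  have key : ∀ n (hn : n < F.p ^ F.c), ‖F.res a - F.res n‖ < 1 → n = finFunctionFinEquiv u := by
    intro n hn h
    rw [← hu (finFunctionFinEquiv.symm ⟨n, hn⟩), Equiv.apply_symm_apply]
    change ‖_‖ < 1
    rw [← res_finFunctionFinEquiv, Equiv.apply_symm_apply]
    exact h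
  exact (key a ha (by simp)).trans (key b hb h).symm

theorem res_zero : F.res 0 = 0 := by simp [res]

theorem lamDigit_zero : F.lamDigit 0 = 0 := by simp [lamDigit_eq, res_zero]

theorem lam_eq_sum {n N : ℕ} (h : n < N) :
    F.lam n = ∑ i ∈ Finset.range N, F.ϖ⁻¹ ^ i * F.lamDigit (n / F.q ^ i % F.q) := by
  refine Finset.sum_subset (Finset.range_subset_range.2 h) fun i _ hi => ?_
  have h1 : n < F.q ^ i := (Nat.lt_pow_self F.one_lt_q).trans_le
    (Nat.pow_le_pow_right F.q_pos (by simp at hi; omega))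
  rw [Nat.div_eq_of_lt h1, Nat.zero_mod, lamDigit_zero, mul_zero]

theorem lam_zero : F.lam 0 = 0 := by simp [lam, lamDigit_zero]

/-- The recursion that strips the last base-q digit. It drives the inductions below and, later, the
passage between consecutive levels. -/
theorem lam_eq (n : ℕ) : F.lam n = F.ϖ⁻¹ * (F.res (n % F.q) + F.lam (n / F.q)) := by
  have h : n / F.q < n + 1 := (Nat.div_le_self _ _).trans_lt (Nat.lt_succ_self _)
  rw [F.lam_eq_sum (show n < n + 1 + 1 by omega), Finset.sum_range_succ', F.lam_eq_sum h,
    lamDigit_eq, pow_zero, pow_zero, Nat.div_one, one_mul, mul_add, Finset.mul_sum, add_comm,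
    mul_comm (F.res _)]
  congr 1
  refine Finset.sum_congr rfl fun i _ => ?_
  rw [Nat.div_div_eq_div_mul, pow_succ', pow_succ', mul_assoc]

theorem ϖ_mul_lam (n : ℕ) : F.ϖ * F.lam n = F.res (n % F.q) + F.lam (n / F.q) := by
  rw [lam_eq, mul_inv_cancel_left₀ F.ϖ_ne_zero]

theorem ϖ_mul_lam_of_lt {t : ℕ} (h : t < F.q) : F.ϖ * F.lam t = F.res t := by
  rw [ϖ_mul_lam, Nat.mod_eq_of_lt h, Nat.div_eq_of_lt h, lam_zero, add_zero]

theorem exists_lam (N : ℕ) : ∀ x : K, ‖x‖ ≤ (F.q : ℝ) ^ N → ∃ k < F.q ^ N, ‖x - F.lam k‖ ≤ 1 := by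
  induction N with
  | zero => intro x hx; exact ⟨0, by simp, by simpa [lam_zero] using hx⟩
  | succ N ih =>
    intro x hx
    -- Multiplication by 𝔭 shrinks the ball by one power of q. The residue of what is left becomes
    -- the last digit t.
    obtain ⟨k, hk, hd⟩ := ih (F.ϖ * x) (by
      rw [norm_mul, norm_ϖ_eq, inv_mul_le_iff₀ F.q_cast_pos, ← pow_succ']
      exact hx)
    obtain ⟨t, ht, ht'⟩ := F.exists_res _ hd
    refine ⟨t + F.q * k, ?_, ?_⟩
    · calc t + F.q * k < F.q + F.q * k := by omega
        _ = F.q * (k + 1) := by ring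
        _ ≤ F.q * F.q ^ N := Nat.mul_le_mul_left _ hk
        _ = F.q ^ (N + 1) := by ring
    · rw [lam_eq, Nat.add_mul_mod_self_left, Nat.mod_eq_of_lt ht, Nat.add_mul_div_left _ _ F.q_pos,
        Nat.div_eq_of_lt ht, zero_add]
      have h1 := F.norm_le_ϖ _ ht'
      have h2 : x - F.ϖ⁻¹ * (F.res t + F.lam k) = F.ϖ⁻¹ * (F.ϖ * x - F.lam k - F.res t) := by
        have := F.ϖ_ne_zero
        field_simp
        ring
      rw [h2, norm_mul, norm_inv, inv_mul_le_iff₀ F.norm_ϖ_pos, mul_one]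
      exact h1

theorem exists_lam_closedBall (x : K) : ∃ k, ‖x - F.lam k‖ ≤ 1 := by
  obtain ⟨N, hN⟩ := pow_unbounded_of_one_lt ‖x‖ (show (1 : ℝ) < F.q by exact_mod_cast F.one_lt_q)
  obtain ⟨k, -, hk⟩ := F.exists_lam N x hN.le
  exact ⟨k, hk⟩

/-- After multiplication by 𝔭 the two points differ by less than 1. Residue representatives have
norm at most 1, so the tails differ by at most 1 and agree by induction; the last digits are then
congruent mod 𝔭, hence equal. -/
theorem lam_injective {k l : ℕ} (h : ‖F.lam k - F.lam l‖ ≤ 1) : k = l := by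
  induction hN : k + l using Nat.strong_induction_on generalizing k l with
  | _ N ih =>
  by_cases h0 : k = 0 ∧ l = 0
  · rw [h0.1, h0.2]
  have hlt : k / F.q + l / F.q < N := by
    have h1 := Nat.div_le_self k F.q
    have h2 := Nat.div_le_self l F.q
    rcases Nat.eq_zero_or_pos k with hk | hk
    · have := Nat.div_lt_self (show 0 < l by omega) F.one_lt_q
      omega
    · have := Nat.div_lt_self hk F.one_lt_q
      omega
  have h1 : ‖F.ϖ * F.lam k - F.ϖ * F.lam l‖ < 1 := by
    rw [← mul_sub, norm_mul]
    exact (mul_le_of_le_one_right (norm_nonneg _) h).trans_lt F.norm_ϖ_lt_one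
  rw [ϖ_mul_lam, ϖ_mul_lam] at h1
  have h3 : ‖F.lam (k / F.q) - F.lam (l / F.q)‖ ≤ 1 := by
    rw [show F.lam (k / F.q) - F.lam (l / F.q) =
        (F.res (k % F.q) + F.lam (k / F.q) - (F.res (l % F.q) + F.lam (l / F.q))) -
          (F.res (k % F.q) - F.res (l % F.q)) by ring]
    exact norm_sub_le_one h1.le (norm_sub_le_one (F.norm_res_le _) (F.norm_res_le _))
  have h4 := ih _ hlt h3 rfl
  rw [h4, add_sub_add_right_eq_sub] at h1
  have h5 := F.res_injective (Nat.mod_lt _ F.q_pos) (Nat.mod_lt _ F.q_pos) h1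
  rw [← Nat.mod_add_div k F.q, ← Nat.mod_add_div l F.q, h4, h5]

/-- The expansion holds modulo 𝔭 by the basis property. Its error y is fixed by the q-th power map,
since this map is additive and fixes the `e i` and the prime field; as |y| < 1, it must vanish. -/
theorem e_mul_e (i l : Fin F.c) : ∃ u : Fin F.c → ℕ, F.e i * F.e l = ∑ n, (u n : K) * F.e n := by
  have := F.char_p
  have : Fact F.p.Prime := ⟨F.p_prime⟩
  obtain ⟨u, hu, -⟩ := F.e_basis (F.e i * F.e l) (by simp [F.norm_e])
  refine ⟨fun n => u n, ?_⟩
  set y := F.e i * F.e l - ∑ n, ((u n : ℕ) : K) * F.e n with hy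
  have hpow : y ^ (F.p ^ F.c) = y := by
    have hn : ∀ n : ℕ, (n : K) ^ (F.p ^ F.c) = n := fun n => by
      have h := map_natCast (iterateFrobenius K F.p F.c) n
      rwa [iterateFrobenius_def] at h
    rw [hy, sub_pow_char_pow, sum_pow_char_pow, mul_pow, F.e_pow, F.e_pow]
    simp only [mul_pow, F.e_pow, hn]
  have hy0 : y = 0 := by
    by_contra h0
    have h1 := congrArg norm hpow
    rw [norm_pow] at h1
    have h2 : ‖y‖ ^ (F.p ^ F.c) < ‖y‖ :=
      pow_lt_self_of_lt_one₀ (norm_pos_iff.2 h0) hu F.one_lt_q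
    exact h2.ne h1
  exact sub_eq_zero.1 hy0

/-- The kernel of `χ`. -/
def kerχ : AddSubgroup K := F.χ.toAddMonoidHom.ker

theorem mem_kerχ {x : K} : x ∈ F.kerχ ↔ F.χ x = 1 := by
  simp [kerχ, AddMonoidHom.mem_ker]

theorem natCast_mul_mem_kerχ (n : ℕ) {x : K} (hx : x ∈ F.kerχ) : (n : K) * x ∈ F.kerχ := by
  rw [← nsmul_eq_mul]
  exact F.kerχ.nsmul_mem hx n

theorem e_mul_zpow_mem_kerχ (i : Fin F.c) {j : ℤ} (hj : j ≠ 1) : F.e i * F.ϖ ^ (-j) ∈ F.kerχ := by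
  rw [mem_kerχ]
  have h := F.χ_apply i j
  rw [if_neg (by tauto)] at h
  exact Circle.ext (by simpa using h)

theorem χ_lam_mul_lam (k l : ℕ) : F.χ (F.lam k * F.lam l) = 1 := by
  rw [← mem_kerχ, lam, lam, Finset.sum_mul_sum]
  refine sum_mem fun a _ => sum_mem fun b _ => ?_
  rw [lamDigit, lamDigit, mul_mul_mul_comm, mul_mul_mul_comm (∑ i, _), Finset.sum_mul_sum,
    mul_left_comm, Finset.sum_mul]
  refine sum_mem fun i _ => ?_
  rw [Finset.sum_mul]
  refine sum_mem fun n _ => ?_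
  have hmem : F.e i * F.e n * (F.ϖ⁻¹ ^ a * F.ϖ⁻¹ ^ b * (F.ϖ⁻¹ * F.ϖ⁻¹)) ∈ F.kerχ := by
    obtain ⟨u, hu⟩ := F.e_mul_e i n
    rw [hu, Finset.sum_mul]
    refine sum_mem fun m _ => ?_
    rw [mul_assoc]
    refine F.natCast_mul_mem_kerχ _ ?_
    have h : F.ϖ⁻¹ ^ a * F.ϖ⁻¹ ^ b * (F.ϖ⁻¹ * F.ϖ⁻¹) = F.ϖ ^ (-((a + b + 2 : ℕ) : ℤ)) := by
      rw [zpow_neg, zpow_natCast, ← inv_pow]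
      ring
    rw [h]
    -- Each λ contributes at least one factor 𝔭⁻¹, so the exponent is at least 2 and misses j = 1,
    -- the only place where χ is nontrivial.
    exact F.e_mul_zpow_mem_kerχ m (by omega)
  convert F.natCast_mul_mem_kerχ (k / F.q ^ a % F.q / F.p ^ (i : ℕ) % F.p)
    (F.natCast_mul_mem_kerχ (l / F.q ^ b % F.q / F.p ^ (n : ℕ) % F.p) hmem) using 1
  ring

theorem exists_χ_ne_one {c : K} (hc : 1 < ‖c‖) : ∃ d : K, ‖d‖ ≤ 1 ∧ F.χ (c * d) ≠ 1 := by
  have h0 : c ≠ 0 := norm_pos_iff.1 (zero_lt_one.trans hc)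
  refine ⟨c⁻¹ * F.ϖ⁻¹, ?_, ?_⟩
  · have := F.norm_le_ϖ c⁻¹ (by rw [norm_inv]; exact inv_lt_one_of_one_lt₀ hc)
    rw [norm_mul, norm_inv F.ϖ]
    exact mul_inv_le_one_of_le₀ this (norm_nonneg _)
  · rw [mul_inv_cancel_left₀ h0]
    exact F.χ_inv_ϖ

end Digits

end LocalFieldData

/-! ### Change of variables for the Haar measure. -/

section Measure

open scoped Pointwise NNReal ENNReal

variable {K : Type*} [NontriviallyNormedField K] [LocallyCompactSpace K]

theorem smul_closedBall_zero (a : Kˣ) (r : ℝ) :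
    a • Metric.closedBall (0 : K) r = Metric.closedBall (0 : K) (‖(a : K)‖ * r) := by
  ext x
  have h : 0 < ‖(a : K)‖ := norm_pos_iff.2 a.ne_zero
  rw [Set.mem_smul_set_iff_inv_smul_mem, mem_closedBall_zero_iff, mem_closedBall_zero_iff,
    Units.smul_def, smul_eq_mul, norm_mul, Units.val_inv_eq_inv_val, norm_inv,
    inv_mul_le_iff₀ h]

theorem preimage_closedBall_add (b : K) (r : ℝ) :
    (fun x => x + b) ⁻¹' Metric.closedBall b r = Metric.closedBall 0 r := by
  ext x
  simp

theorem norm_sub_le_of_mem_closedBall [IsUltrametricDist K] {x a b : K} {r : ℝ}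
    (ha : x ∈ Metric.closedBall a r) (hb : x ∈ Metric.closedBall b r) : ‖a - b‖ ≤ r := by
  rw [mem_closedBall_iff_norm'] at ha
  rw [mem_closedBall_iff_norm] at hb
  rw [← sub_add_sub_cancel a x b]
  exact (IsUltrametricDist.norm_add_le_max _ _).trans (max_le ha hb)

variable [MeasurableSpace K] [BorelSpace K]

instance : (haar K).Regular := by
  unfold haar; infer_instance

theorem haar_unitBall : haar K (Metric.closedBall 0 1) = 1 :=
  Measure.addHaarMeasure_self (K₀ := unitBall K)

theorem haar_preimage_mul (a : Kˣ) (s : Set K) :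
    haar K ((fun x => (a : K) * x) ⁻¹' s) = (distribHaarChar K a)⁻¹ * haar K s := by
  have h : (fun x => (a : K) * x) ⁻¹' s = a⁻¹ • s := Set.preimage_smul a s
  rw [h, ← distribHaarChar_mul, map_inv]

/-- The hypothesis `ha` says that the absolute value is normalized at `a`. It is verified for the
powers of 𝔭 in `distribHaarChar_ϖu_zpow`. -/
theorem map_mul_haar {a : Kˣ} (ha : distribHaarChar K a = ‖(a : K)‖₊) :
    Measure.map (fun x => (a : K) * x) (haar K) = (‖(a : K)‖₊⁻¹ : ℝ≥0) • haar K := by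
  ext s hs
  rw [Measure.map_apply (by fun_prop) hs, haar_preimage_mul, ha, Measure.smul_apply,
    ENNReal.smul_def, smul_eq_mul, ENNReal.coe_inv (nnnorm_ne_zero_iff.2 a.ne_zero)]

theorem integral_comp_mul {a : Kˣ} (ha : distribHaarChar K a = ‖(a : K)‖₊) (f : K → ℂ) :
    ∫ x, f (a * x) ∂(haar K) = ((‖(a : K)‖⁻¹ : ℝ) : ℂ) * ∫ x, f x ∂(haar K) := by
  have h := (Homeomorph.mulLeft₀ (a : K) a.ne_zero).measurableEmbedding.integral_map
    (μ := haar K) f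
  have h2 : Measure.map (Homeomorph.mulLeft₀ (a : K) a.ne_zero) (haar K) =
      (‖(a : K)‖₊⁻¹ : ℝ≥0) • haar K := map_mul_haar (a := a) ha
  rw [h2, integral_smul_nnreal_measure] at h
  rw [← Complex.real_smul]
  exact h.symm

theorem integrable_comp_mul_iff {a : Kˣ} (ha : distribHaarChar K a = ‖(a : K)‖₊)
    {E : Type*} [NormedAddCommGroup E] {f : K → E} :
    Integrable (fun x => f (a * x)) (haar K) ↔ Integrable f (haar K) := by
  have h := (Homeomorph.mulLeft₀ (a : K) a.ne_zero).measurableEmbedding.integrable_map_iff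
    (μ := haar K) (g := f)
  have h2 : Measure.map (Homeomorph.mulLeft₀ (a : K) a.ne_zero) (haar K) =
      (‖(a : K)‖₊⁻¹ : ℝ≥0) • haar K := map_mul_haar (a := a) ha
  rw [h2] at h
  refine h.symm.trans (integrable_smul_measure (c := ((‖(a : K)‖₊⁻¹ : ℝ≥0) : ℝ≥0∞)) ?_ ?_)
  · simp
  · simp

theorem locallyIntegrable_comp_mul {a : Kˣ} (ha : distribHaarChar K a = ‖(a : K)‖₊)
    {f : K → ℂ} (hf : LocallyIntegrable f (haar K)) :
    LocallyIntegrable (fun x => f (a * x)) (haar K) := by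
  have h := locallyIntegrable_map_homeomorph (Homeomorph.mulLeft₀ (a : K) a.ne_zero)
    (μ := haar K) (f := f)
  have h2 : Measure.map (Homeomorph.mulLeft₀ (a : K) a.ne_zero) (haar K) =
      (‖(a : K)‖₊⁻¹ : ℝ≥0) • haar K := map_mul_haar (a := a) ha
  rw [h2] at h
  refine h.1 fun x => ?_
  obtain ⟨s, hs, hi⟩ := hf x
  refine ⟨s, hs, ?_⟩
  rw [IntegrableOn, Measure.restrict_smul]
  exact hi.smul_measure_nnreal

theorem quasiMeasurePreserving_mul {a : Kˣ} (ha : distribHaarChar K a = ‖(a : K)‖₊) :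
    Measure.QuasiMeasurePreserving (fun x => (a : K) * x) (haar K) (haar K) := by
  refine ⟨by fun_prop, ?_⟩
  rw [map_mul_haar ha]
  exact Measure.smul_absolutelyContinuous

theorem setIntegral_closedBall_add {E : Type*} [NormedAddCommGroup E] [NormedSpace ℝ E]
    (f : K → E) (b : K) (r : ℝ) :
    ∫ x in Metric.closedBall b r, f x ∂(haar K) =
      ∫ x in Metric.closedBall 0 r, f (x + b) ∂(haar K) := by
  rw [← preimage_closedBall_add b r]
  exact ((measurePreserving_add_right (haar K) b).setIntegral_preimage_emb
    (measurableEmbedding_addRight b) f _).symm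

end Measure

namespace LocalFieldData

/-! ### Normalization of the measure, decomposition of K into translates of D, and integrals of
characters over balls. -/

section Measure

open scoped Pointwise NNReal ENNReal

variable {K : Type*} [NontriviallyNormedField K] [IsUltrametricDist K] [LocallyCompactSpace K]
  (F : LocalFieldData K) [MeasurableSpace K] [BorelSpace K]

theorem closedBall_eq_iUnion_res :
    Metric.closedBall (0 : K) 1 = ⋃ t : Fin F.q, Metric.closedBall (F.res t) ‖F.ϖ‖ := by
  ext x
  simp only [Set.mem_iUnion, mem_closedBall_iff_norm, sub_zero]
  constructor
  · intro hx
    obtain ⟨n, hn, h⟩ := F.exists_res x hx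
    exact ⟨⟨n, hn⟩, F.norm_le_ϖ _ h⟩
  · rintro ⟨t, ht⟩
    rw [← sub_add_cancel x (F.res t)]
    exact (IsUltrametricDist.norm_add_le_max _ _).trans
      (max_le (ht.trans F.norm_ϖ_lt_one.le) (F.norm_res_le _))

/-- D is the disjoint union of q translates of this ball, all of the same measure. -/
theorem haar_closedBall_ϖ : haar K (Metric.closedBall 0 ‖F.ϖ‖) = (F.q : ℝ≥0∞)⁻¹ := by
  have h := haar_unitBall (K := K)
  rw [F.closedBall_eq_iUnion_res, measure_iUnion, tsum_fintype] at h
  · simp_rw [Measure.addHaar_closedBall_center] at h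
    rw [Finset.sum_const, Finset.card_univ, Fintype.card_fin, nsmul_eq_mul] at h
    rw [mul_comm] at h
    exact ENNReal.eq_inv_of_mul_eq_one_left h
  · intro s t hst
    refine Set.disjoint_left.2 fun x hs ht => hst ?_
    exact Fin.ext (F.res_injective s.2 t.2
      ((norm_sub_le_of_mem_closedBall hs ht).trans_lt F.norm_ϖ_lt_one))
  · exact fun _ => measurableSet_closedBall

theorem distribHaarChar_ϖu : distribHaarChar K F.ϖu = ‖F.ϖ‖₊ := by
  refine distribHaarChar_eq_of_measure_smul_eq_mul (μ := haar K) (s := Metric.closedBall 0 1)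
    ?_ ?_ ?_
  · rw [haar_unitBall]; exact one_ne_zero
  · rw [haar_unitBall]; exact ENNReal.one_ne_top
  · rw [smul_closedBall_zero, mul_one, haar_unitBall, mul_one]
    have h : ‖F.ϖ‖₊ = (F.q : ℝ≥0)⁻¹ := NNReal.eq (by simpa using F.norm_ϖ_eq)
    rw [h, ENNReal.coe_inv (by exact_mod_cast F.q_pos.ne'), ENNReal.coe_natCast]
    exact F.haar_closedBall_ϖ

theorem distribHaarChar_ϖu_zpow (j : ℤ) :
    distribHaarChar K (F.ϖu ^ j) = ‖((F.ϖu ^ j : Kˣ) : K)‖₊ := by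
  rw [map_zpow, distribHaarChar_ϖu, Units.val_zpow_eq_zpow_val, nnnorm_zpow]
  rfl

theorem norm_ϖu_zpow (j : ℤ) : ‖((F.ϖu ^ j : Kˣ) : K)‖ = (F.q : ℝ) ^ (-j) := by
  rw [Units.val_zpow_eq_zpow_val, norm_zpow, show ((F.ϖu : Kˣ) : K) = F.ϖ from rfl, norm_ϖ_eq,
    inv_zpow, zpow_neg]

theorem haar_closedBall_zpow (j : ℤ) :
    haar K (Metric.closedBall 0 ((F.q : ℝ) ^ j)) = ENNReal.ofReal ((F.q : ℝ) ^ j) := by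
  have h := distribHaarChar_mul (haar K) (F.ϖu ^ (-j)) (Metric.closedBall (0 : K) 1)
  rw [smul_closedBall_zero, mul_one, haar_unitBall, mul_one, norm_ϖu_zpow, neg_neg] at h
  rw [← h, distribHaarChar_ϖu_zpow, ← enorm_eq_nnnorm, ← ofReal_norm, norm_ϖu_zpow,
    neg_neg]

theorem iUnion_closedBall_lam : ⋃ k, Metric.closedBall (F.lam k) 1 = Set.univ := by
  refine Set.eq_univ_of_forall fun x => Set.mem_iUnion.2 ?_
  obtain ⟨k, hk⟩ := F.exists_lam_closedBall x
  exact ⟨k, mem_closedBall_iff_norm.2 hk⟩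

theorem pairwise_disjoint_closedBall_lam :
    Pairwise (Function.onFun Disjoint fun k => Metric.closedBall (F.lam k) 1) :=
  fun _ _ hkl => Set.disjoint_left.2 fun _ hk hl =>
    hkl (F.lam_injective (norm_sub_le_of_mem_closedBall hk hl))

theorem hasSum_integral_lam {E : Type*} [NormedAddCommGroup E] [NormedSpace ℝ E] {f : K → E}
    (hf : Integrable f (haar K)) :
    HasSum (fun k => ∫ x in Metric.closedBall 0 1, f (x + F.lam k) ∂(haar K))
      (∫ x, f x ∂(haar K)) := by
  have h := hasSum_integral_iUnion (f := f) (μ := haar K)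
    (s := fun k => Metric.closedBall (F.lam k) 1)
    (fun _ => measurableSet_closedBall) F.pairwise_disjoint_closedBall_lam
    hf.integrableOn
  rw [iUnion_closedBall_lam, setIntegral_univ] at h
  convert h using 2 with k
  exact (setIntegral_closedBall_add f (F.lam k) 1).symm

theorem lintegral_eq_tsum_lam (f : K → ℝ≥0∞) :
    ∫⁻ x, f x ∂(haar K) =
      ∑' k, ∫⁻ x in Metric.closedBall 0 1, f (x + F.lam k) ∂(haar K) := by
  have h := lintegral_iUnion (μ := haar K) (s := fun k => Metric.closedBall (F.lam k) 1)
    (fun _ => measurableSet_closedBall) F.pairwise_disjoint_closedBall_lam f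
  rw [iUnion_closedBall_lam, setLIntegral_univ] at h
  rw [h]
  refine tsum_congr fun k => ?_
  have h1 := ((measurePreserving_add_right (haar K) (F.lam k)).setLIntegral_comp_preimage_emb
    (measurableEmbedding_addRight _) f (Metric.closedBall (F.lam k) 1))
  rw [preimage_closedBall_add] at h1
  exact h1.symm

/-- Translation by d preserves the ball and multiplies the integral by χ(cd) ≠ 1. -/
theorem integral_χ_eq_zero {c d : K} {r : ℝ} (hd : ‖d‖ ≤ r) (h : F.χ (c * d) ≠ 1) :
    ∫ x in Metric.closedBall 0 r, (F.χ (c * x) : ℂ) ∂(haar K) = 0 := by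
  have hball : Metric.closedBall d r = Metric.closedBall 0 r :=
    IsUltrametricDist.closedBall_eq_of_mem (by simpa using hd)
  have h1 := setIntegral_closedBall_add (fun x => (F.χ (c * x) : ℂ)) d r
  simp only [hball, mul_add, AddChar.map_add_eq_mul, Circle.coe_mul] at h1
  rw [integral_mul_const] at h1
  have h2 : (∫ x in Metric.closedBall 0 r, (F.χ (c * x) : ℂ) ∂(haar K)) *
      ((F.χ (c * d) : ℂ) - 1) = 0 := by
    rw [mul_sub, mul_one, sub_eq_zero]
    exact h1.symm
  rcases mul_eq_zero.1 h2 with h3 | h3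
  · exact h3
  · exact absurd (Circle.ext (by simpa using sub_eq_zero.1 h3)) h

theorem integral_χ_unitBall (c : K) :
    ∫ x in Metric.closedBall 0 1, (F.χ (c * x) : ℂ) ∂(haar K) = if ‖c‖ ≤ 1 then 1 else 0 := by
  split_ifs with h
  · have h1 : ∀ x ∈ Metric.closedBall (0 : K) 1, (F.χ (c * x) : ℂ) = 1 := fun x hx => by
      rw [F.χ_trivial, Circle.coe_one]
      rw [norm_mul]
      exact mul_le_one₀ h (norm_nonneg _) (by simpa using hx)
    rw [setIntegral_congr_fun measurableSet_closedBall h1]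
    simp [Measure.real, haar_unitBall]
  · obtain ⟨d, hd, h1⟩ := F.exists_χ_ne_one (not_le.1 h)
    exact F.integral_χ_eq_zero hd h1

/-- The integral of `χ(c ·)` over the ball of radius `qᴺ`. -/
theorem integral_χ_closedBall (c : K) (N : ℤ) :
    ∫ x in Metric.closedBall 0 ((F.q : ℝ) ^ N), (F.χ (c * x) : ℂ) ∂(haar K) =
      if ‖c‖ ≤ (F.q : ℝ) ^ (-N) then (F.q : ℂ) ^ N else 0 := by
  have hq := zpow_pos F.q_cast_pos N
  split_ifs with h
  · have h1 : ∀ x ∈ Metric.closedBall (0 : K) ((F.q : ℝ) ^ N), (F.χ (c * x) : ℂ) = 1 := by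
      intro x hx
      rw [F.χ_trivial, Circle.coe_one]
      rw [mem_closedBall_zero_iff] at hx
      rw [norm_mul]
      calc ‖c‖ * ‖x‖ ≤ (F.q : ℝ) ^ (-N) * (F.q : ℝ) ^ N := by gcongr
        _ = 1 := by rw [zpow_neg, inv_mul_cancel₀ hq.ne']
    rw [setIntegral_congr_fun measurableSet_closedBall h1]
    simp [Measure.real, haar_closedBall_zpow, ENNReal.toReal_ofReal hq.le]
  · set b : K := ((F.ϖu ^ (-N) : Kˣ) : K) with hb
    have hbn : ‖b‖ = (F.q : ℝ) ^ N := by rw [hb, norm_ϖu_zpow, neg_neg]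
    obtain ⟨d, hd, h1⟩ := F.exists_χ_ne_one (c := c * b) (by
      rw [norm_mul, hbn]
      rw [not_le, zpow_neg] at h
      rwa [inv_lt_iff_one_lt_mul₀ hq] at h)
    refine F.integral_χ_eq_zero (d := b * d) ?_ (by rwa [← mul_assoc])
    rw [norm_mul, hbn]
    exact mul_le_of_le_one_right hq.le hd

end Measure

end LocalFieldData

/-! ### Test functions separate locally integrable functions. -/

section TestFunctions

variable {K : Type*} [NontriviallyNormedField K] [LocallyCompactSpace K]

/-- The indicator function of a closed ball, as a test function. -/
def indicatorTest [IsUltrametricDist K] (a : K) {r : ℝ} (hr : r ≠ 0) : TestFun K :=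
  ⟨(Metric.closedBall a r).indicator 1, by
    have : ProperSpace K := ProperSpace.of_locallyCompactSpace K
    exact ⟨(LocallyConstant.charFn ℂ (IsUltrametricDist.isClopen_closedBall a hr)).isLocallyConstant,
      HasCompactSupport.intro (isCompact_closedBall a r) fun x hx => Set.indicator_of_notMem hx _⟩⟩

theorem substTest_apply (a : Kˣ) (b : K) (f : TestFun K) (x : K) :
    (substTest a b f).1 x = f.1 ((a⁻¹ : Kˣ) * (x + b)) := rfl

variable [MeasurableSpace K] [BorelSpace K]

theorem integrable_mul_testFun {g : K → ℂ} (hg : LocallyIntegrable g (haar K)) (f : TestFun K) :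
    Integrable (fun x => g x * f.1 x) (haar K) := by
  have h := hg.integrable_smul_right_of_hasCompactSupport f.2.1.continuous f.2.2
  simpa only [smul_eq_mul] using h

/-- Indicators of balls are test functions. Two ultrametric balls are nested or disjoint, so balls
form a π-system generating the Borel sets, and vanishing integrals extend from balls to all Borel
sets. -/
theorem ae_eq_zero_of_forall_testFun [IsUltrametricDist K] {g : K → ℂ}
    (hg : LocallyIntegrable g (haar K))
    (h : ∀ f : TestFun K, ∫ x, g x * f.1 x ∂(haar K) = 0) : g =ᵐ[haar K] 0 := by
  have : ProperSpace K := ProperSpace.of_locallyCompactSpace K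
  have hball : ∀ (a : K) (r : ℝ), 0 < r → ∫ x in Metric.closedBall a r, g x ∂(haar K) = 0 := by
    intro a r hr
    rw [← h (indicatorTest a hr.ne'), ← integral_indicator measurableSet_closedBall]
    congr 1
    ext x
    by_cases hx : x ∈ Metric.closedBall a r <;> simp [indicatorTest, hx]
  have hgen : ‹MeasurableSpace K› =
      MeasurableSpace.generateFrom {s | ∃ (a : K) (r : ℝ), 0 < r ∧ s = Metric.closedBall a r} := by
    rw [BorelSpace.measurable_eq (α := K)]
    refine TopologicalSpace.IsTopologicalBasis.borel_eq_generateFrom ?_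
    refine TopologicalSpace.isTopologicalBasis_of_isOpen_of_nhds ?_ ?_
    · rintro _ ⟨a, r, hr, rfl⟩
      exact IsUltrametricDist.isOpen_closedBall a hr.ne'
    · intro a u ha hu
      obtain ⟨r, hr, hru⟩ := Metric.nhds_basis_closedBall.mem_iff.1 (hu.mem_nhds ha)
      exact ⟨_, ⟨a, r, hr, rfl⟩, Metric.mem_closedBall_self hr.le, hru⟩
  have hinter : ∀ (a b : K) (r t : ℝ), (Metric.closedBall a r ∩ Metric.closedBall b t).Nonempty →
      Metric.closedBall a r ∩ Metric.closedBall b t = Metric.closedBall a r ∨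
      Metric.closedBall a r ∩ Metric.closedBall b t = Metric.closedBall b t := by
    rintro a b r t ⟨x, hxa, hxb⟩
    rw [IsUltrametricDist.closedBall_eq_of_mem hxa, IsUltrametricDist.closedBall_eq_of_mem hxb]
    rcases le_total r t with hrt | hrt
    · exact Or.inl (Set.inter_eq_left.2 (Metric.closedBall_subset_closedBall hrt))
    · exact Or.inr (Set.inter_eq_right.2 (Metric.closedBall_subset_closedBall hrt))
  -- Cutting down to a fixed ball makes g integrable, as complements and countable unions require;
  -- the radius n + 1 is positive even for n = 0.
  have key : ∀ n : ℕ, ∀ s : Set K, MeasurableSet s →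
      ∫ x in s ∩ Metric.closedBall 0 (n + 1 : ℝ), g x ∂(haar K) = 0 := by
    intro n
    have hn : (0 : ℝ) < n + 1 := by positivity
    have hint : IntegrableOn g (Metric.closedBall 0 (n + 1 : ℝ)) (haar K) :=
      hg.integrableOn_isCompact (isCompact_closedBall _ _)
    refine MeasurableSpace.induction_on_inter hgen ?_ (by simp) ?_ ?_ ?_
    · rintro _ ⟨a, r, hr, rfl⟩ _ ⟨b, t, ht, rfl⟩ hne
      rcases hinter a b r t hne with h1 | h1
      · exact ⟨a, r, hr, h1⟩
      · exact ⟨b, t, ht, h1⟩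
    · rintro _ ⟨a, r, hr, rfl⟩
      rcases Set.eq_empty_or_nonempty (Metric.closedBall a r ∩ Metric.closedBall 0 (n + 1 : ℝ))
        with h1 | h1
      · simp [h1]
      · rcases hinter _ _ _ _ h1 with h2 | h2 <;> rw [h2]
        · exact hball _ _ hr
        · exact hball _ _ hn
    · intro t ht h1
      have h2 := setIntegral_union (f := g) (μ := haar K)
        (s := t ∩ Metric.closedBall 0 (n + 1 : ℝ)) (t := tᶜ ∩ Metric.closedBall 0 (n + 1 : ℝ))
        (disjoint_compl_right.mono Set.inter_subset_left Set.inter_subset_left)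
        (ht.compl.inter measurableSet_closedBall) (hint.mono_set Set.inter_subset_right)
        (hint.mono_set Set.inter_subset_right)
      rw [← Set.union_inter_distrib_right, Set.union_compl_self, Set.univ_inter, hball _ _ hn, h1,
        zero_add] at h2
      exact h2.symm
    · intro f hd hm h1
      have h2 := hasSum_integral_iUnion (f := g) (μ := haar K)
        (s := fun i => f i ∩ Metric.closedBall 0 (n + 1 : ℝ))
        (fun i => (hm i).inter measurableSet_closedBall)
        (fun i j hij => (hd hij).mono Set.inter_subset_left Set.inter_subset_left)
        (hint.mono_set (Set.iUnion_subset fun i => Set.inter_subset_right))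
      simp only [h1] at h2
      rw [Set.iUnion_inter]
      exact h2.unique hasSum_zero
  have hae : ∀ n : ℕ, ∀ᵐ x ∂(haar K), x ∈ Metric.closedBall (0 : K) (n + 1 : ℝ) → g x = 0 := by
    intro n
    have hint : IntegrableOn g (Metric.closedBall 0 (n + 1 : ℝ)) (haar K) :=
      hg.integrableOn_isCompact (isCompact_closedBall _ _)
    refine (ae_restrict_iff' measurableSet_closedBall).1 ?_
    refine Integrable.ae_eq_zero_of_forall_setIntegral_eq_zero hint fun s hs _ => ?_
    rw [Measure.restrict_restrict hs]
    exact key n s hs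
  filter_upwards [ae_all_iff.2 hae] with x hx
  obtain ⟨n, hn⟩ := exists_nat_ge ‖x‖
  exact hx n (by rw [mem_closedBall_zero_iff]; linarith)

end TestFunctions

namespace LocalFieldData

/-! ### Fourier inversion, and uniqueness of Fourier transforms. -/

section Fourier

variable {K : Type*} [NontriviallyNormedField K] [IsUltrametricDist K] [LocallyCompactSpace K]
  (F : LocalFieldData K) [MeasurableSpace K] [BorelSpace K]

theorem fourierTest_apply (f : TestFun K) (ξ : K) :
    (F.fourierTest f).1 ξ = ∫ x, (F.χ (-(x * ξ)) : ℂ) * f.1 x ∂(haar K) := rfl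

theorem integral_fourier_mul_eq {f g : K → ℂ} (hf : Integrable f (haar K))
    (hg : Integrable g (haar K)) :
    ∫ ξ, (∫ x, (F.χ (-(x * ξ)) : ℂ) * f x ∂(haar K)) * g ξ ∂(haar K) =
      ∫ x, f x * ∫ ξ, (F.χ (-(x * ξ)) : ℂ) * g ξ ∂(haar K) ∂(haar K) := by
  have : ProperSpace K := ProperSpace.of_locallyCompactSpace K
  have h := VectorFourier.integral_fourierIntegral_smul_eq_flip (e := F.χ) (μ := haar K)
    (ν := haar K) (L := LinearMap.mul K K) F.χ_cont
    (show Continuous fun p : K × K => p.1 * p.2 from continuous_mul) hf hg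
  simp only [VectorFourier.fourierIntegral, Circle.smul_def, smul_eq_mul, LinearMap.flip_apply,
    LinearMap.mul_apply'] at h
  exact h

theorem exists_pow_gt (R : ℝ) : ∃ N : ℕ, R < (F.q : ℝ) ^ (N : ℤ) := by
  obtain ⟨N, hN⟩ := pow_unbounded_of_one_lt R (show (1 : ℝ) < F.q by exact_mod_cast F.one_lt_q)
  exact ⟨N, by rwa [zpow_natCast]⟩

/-- Fourier inversion for test functions. -/
theorem fourierTest_fourierTest (f : TestFun K) (η : K) :
    (F.fourierTest (F.fourierTest f)).1 η = f.1 (-η) := by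
  have : ProperSpace K := ProperSpace.of_locallyCompactSpace K
  obtain ⟨R, hR⟩ := (F.fourierTest f).2.2.isCompact.isBounded.subset_closedBall (0 : K)
  obtain ⟨δ, hδ, hf⟩ := TestFun.exists_uniform f
  -- The ball of radius qᴺ contains the support of the transform of f, and f is constant on balls of
  -- radius q⁻ᴺ.
  obtain ⟨N, hN⟩ := F.exists_pow_gt (max R δ⁻¹)
  have hN1 : R < (F.q : ℝ) ^ (N : ℤ) := (le_max_left _ _).trans_lt hN
  have hq : (0 : ℝ) < (F.q : ℝ) ^ (N : ℤ) := zpow_pos F.q_cast_pos _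
  have hN2 : (F.q : ℝ) ^ (-(N : ℤ)) < δ := by
    rw [zpow_neg]
    exact inv_lt_of_inv_lt₀ hδ ((le_max_right _ _).trans_lt hN)
  set B : Set K := Metric.closedBall 0 ((F.q : ℝ) ^ (N : ℤ)) with hB
  have hcont : Continuous fun x : K => (F.χ (-(x * η)) : ℂ) :=
    continuous_induced_dom.comp (F.χ_cont.comp (by fun_prop))
  have hg : Integrable (B.indicator fun x => (F.χ (-(x * η)) : ℂ)) (haar K) := by
    refine IntegrableOn.integrable_indicator ?_ measurableSet_closedBall
    exact hcont.continuousOn.integrableOn_compact (isCompact_closedBall _ _)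
  have h1 := F.integral_fourier_mul_eq (TestFun.integrable f) hg
  have h2 : (F.fourierTest (F.fourierTest f)).1 η = ∫ ξ, (∫ x, (F.χ (-(x * ξ)) : ℂ) * f.1 x
      ∂(haar K)) * B.indicator (fun x => (F.χ (-(x * η)) : ℂ)) ξ ∂(haar K) := by
    rw [fourierTest_apply]
    congr 1
    ext x
    rw [← fourierTest_apply]
    by_cases hx : x ∈ B
    · rw [Set.indicator_of_mem hx, mul_comm]
    · have h0 : (F.fourierTest f).1 x = 0 := image_eq_zero_of_notMem_tsupport
        fun hx' => hx (Metric.closedBall_subset_closedBall hN1.le (hR hx'))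
      rw [Set.indicator_of_notMem hx, mul_zero, h0, mul_zero]
  -- The transform of the truncated character is qᴺ times the indicator of a ball of measure q⁻ᴺ
  -- about −η, an exact approximate identity for f.
  have h3 : ∀ x : K, ∫ ξ, (F.χ (-(x * ξ)) : ℂ) * B.indicator (fun x => (F.χ (-(x * η)) : ℂ)) ξ
      ∂(haar K) = (Metric.closedBall (-η) ((F.q : ℝ) ^ (-(N : ℤ)))).indicator
        (fun _ => (F.q : ℂ) ^ (N : ℤ)) x := by
    intro x
    have h4 := F.integral_χ_closedBall (-(x + η)) N
    rw [← hB, ← integral_indicator measurableSet_closedBall] at h4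
    classical
    rw [Set.indicator_apply, mem_closedBall_iff_norm, sub_neg_eq_add, ← norm_neg (x + η), ← h4]
    congr 1
    ext ξ
    by_cases hξ : ξ ∈ B
    · rw [Set.indicator_of_mem hξ, Set.indicator_of_mem hξ, ← Circle.coe_mul,
        ← AddChar.map_add_eq_mul]
      congr 2
      ring
    · rw [Set.indicator_of_notMem hξ, Set.indicator_of_notMem hξ, mul_zero]
  rw [h2, h1]
  simp only [h3]
  have h5 : ∀ x, f.1 x * (Metric.closedBall (-η) ((F.q : ℝ) ^ (-(N : ℤ)))).indicator
        (fun _ => (F.q : ℂ) ^ (N : ℤ)) x =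
      (Metric.closedBall (-η) ((F.q : ℝ) ^ (-(N : ℤ)))).indicator
        (fun _ => f.1 (-η) * (F.q : ℂ) ^ (N : ℤ)) x := by
    intro x
    by_cases hx : x ∈ Metric.closedBall (-η) ((F.q : ℝ) ^ (-(N : ℤ)))
    · rw [Set.indicator_of_mem hx, Set.indicator_of_mem hx]
      rw [mem_closedBall_iff_norm] at hx
      have := hf (-η) (x - -η) (hx.trans_lt hN2)
      rw [add_sub_cancel] at this
      rw [this]
    · rw [Set.indicator_of_notMem hx, Set.indicator_of_notMem hx, mul_zero]
  simp only [h5]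
  rw [integral_indicator measurableSet_closedBall, setIntegral_const, Measure.real,
    Measure.addHaar_closedBall_center, haar_closedBall_zpow,
    ENNReal.toReal_ofReal (zpow_nonneg F.q_cast_pos.le _), Complex.real_smul]
  have hqc : (F.q : ℂ) ≠ 0 := by exact_mod_cast F.q_pos.ne'
  push_cast
  rw [mul_left_comm, ← zpow_add₀ hqc, neg_add_cancel, zpow_zero, mul_one]

/-- The inverse Fourier transform on test functions. -/
def invFourierTest : TestFun K →ₗ[ℂ] TestFun K := F.fourierTest ∘ₗ substTest (-1) 0

theorem fourierTest_invFourierTest (f : TestFun K) : F.fourierTest (F.invFourierTest f) = f := by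
  ext x
  rw [invFourierTest, LinearMap.comp_apply, fourierTest_fourierTest, substTest_apply]
  simp

theorem fourierTest_injective : Function.Injective F.fourierTest := by
  intro f g h
  ext x
  rw [← neg_neg x, ← fourierTest_fourierTest, h, fourierTest_fourierTest]

theorem invFourierTest_fourierTest (f : TestFun K) : F.invFourierTest (F.fourierTest f) = f :=
  F.fourierTest_injective (F.fourierTest_invFourierTest _)

theorem fourierDistrib_injective {u v : TemperedDistrib K}
    (h : ∀ f, F.fourierDistrib u f = F.fourierDistrib v f) : u = v := by
  ext f
  rw [← F.fourierTest_invFourierTest f]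
  exact h _

theorem HasFourierFun.ae_eq {u : TemperedDistrib K} {g g' : K → ℂ} (h : F.HasFourierFun u g)
    (h' : F.HasFourierFun u g') : g =ᵐ[haar K] g' := by
  have h1 : g - g' =ᵐ[haar K] 0 := by
    refine ae_eq_zero_of_forall_testFun (h.1.sub h'.1) fun f => ?_
    simp only [Pi.sub_apply, sub_mul]
    rw [integral_sub (integrable_mul_testFun h.1 f) (integrable_mul_testFun h'.1 f), ← h.2, ← h'.2,
      sub_self]
  filter_upwards [h1] with x hx
  exact sub_eq_zero.1 hx

theorem hasFourierFun_fourierFun {u : TemperedDistrib K} (h : ∃ g, F.HasFourierFun u g) :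
    F.HasFourierFun u (F.fourierFun u) := by
  rw [fourierFun, dif_pos h]
  exact h.choose_spec

theorem HasFourierFun.fourierFun_ae_eq {u : TemperedDistrib K} {g : K → ℂ}
    (h : F.HasFourierFun u g) : F.fourierFun u =ᵐ[haar K] g :=
  (F.hasFourierFun_fourierFun ⟨g, h⟩).ae_eq F h

/-- Every test function is a Fourier transform, and exchanging the order of integration moves that
transform onto g, where it vanishes. -/
theorem ae_eq_zero_of_forall_integral_χ {g : K → ℂ} (hg : Integrable g (haar K))
    (h : ∀ y, ∫ x, (F.χ (y * x) : ℂ) * g x ∂(haar K) = 0) : g =ᵐ[haar K] 0 := by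
  refine ae_eq_zero_of_forall_testFun hg.locallyIntegrable fun f => ?_
  rw [← F.fourierTest_invFourierTest f]
  set k := F.invFourierTest f
  have h1 := F.integral_fourier_mul_eq hg (TestFun.integrable k)
  have h2 : ∀ ξ, ∫ x, (F.χ (-(x * ξ)) : ℂ) * g x ∂(haar K) = 0 := fun ξ => by
    rw [← h (-ξ)]
    congr 1
    ext x
    rw [neg_mul, mul_comm x]
  simp only [h2, zero_mul, integral_zero] at h1
  rw [h1]
  congr 1
  ext x
  rw [fourierTest_apply]
  simp only [mul_comm x]

end Fourier

/-! ### Fourier transforms of dilated and translated distributions. -/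

section Affine

variable {K : Type*} [NontriviallyNormedField K] [IsUltrametricDist K] [LocallyCompactSpace K]
  (F : LocalFieldData K) [MeasurableSpace K] [BorelSpace K]

theorem continuous_χ_coe {f : K → K} (hf : Continuous f) : Continuous fun x => (F.χ (f x) : ℂ) :=
  continuous_induced_dom.comp (F.χ_cont.comp hf)

theorem χ_neg_coe (x : K) : (F.χ (-x) : ℂ) = conj (F.χ x : ℂ) := by
  rw [AddChar.map_neg_eq_inv, Circle.coe_inv_eq_conj]

/-- The test function `z ↦ χ(-z b) f(a z)`. -/
def modTest (a : Kˣ) (b : K) (f : TestFun K) : TestFun K :=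
  ⟨fun z => (F.χ (-(z * b)) : ℂ) * f.1 (a * z), by
    let h : K ≃ₜ K := Homeomorph.mulLeft₀ (a : K) a.ne_zero
    refine ⟨IsLocallyConstant.mul (f := fun z => (F.χ (-(z * b)) : ℂ)) ?_
      (f.2.1.comp_continuous h.continuous), (f.2.2.comp_homeomorph h).mul_left⟩
    rw [IsLocallyConstant.iff_eventually_eq]
    intro x
    have h1 : ∀ᶠ y in 𝓝 x, ‖(y - x) * b‖ < 1 := by
      have hc : Continuous fun y => ‖(y - x) * b‖ := by fun_prop
      exact hc.continuousAt.eventually_lt continuousAt_const (by simp)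
    filter_upwards [h1] with y hy
    rw [show -(y * b) = -((y - x) * b) + -(x * b) by ring, AddChar.map_add_eq_mul,
      F.χ_trivial _ (by rw [norm_neg]; exact hy.le), one_mul]⟩

theorem modTest_apply (a : Kˣ) (b : K) (f : TestFun K) (z : K) :
    (F.modTest a b f).1 z = (F.χ (-(z * b)) : ℂ) * f.1 (a * z) := rfl

theorem substTest_fourierTest {a : Kˣ} (ha : distribHaarChar K a = ‖(a : K)‖₊) (b : K)
    (f : TestFun K) : substTest a b (F.fourierTest f) =
      (‖(a : K)‖ : ℂ) • F.fourierTest (F.modTest a b f) := by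
  ext ξ
  rw [substTest_apply, fourierTest_apply]
  change _ = (‖(a : K)‖ : ℂ) * (F.fourierTest (F.modTest a b f)).1 ξ
  rw [fourierTest_apply]
  have hn : (‖(a : K)‖ : ℂ) ≠ 0 := by exact_mod_cast norm_ne_zero_iff.2 a.ne_zero
  have h := integral_comp_mul ha
    (fun y => (F.χ (-(y * ((a⁻¹ : Kˣ) * (ξ + b)))) : ℂ) * f.1 y)
  rw [← mul_right_inj' hn] at h
  push_cast at h
  rw [mul_inv_cancel_left₀ hn] at h
  push_cast
  rw [← h]
  congr 2
  ext x
  have h1 : -(a * x * ((a⁻¹ : Kˣ) * (ξ + b))) = -(x * ξ) + -(x * b) := by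
    rw [mul_comm (a : K) x, mul_assoc, Units.mul_inv_cancel_left]
    ring
  push_cast at h1
  rw [modTest_apply, h1, AddChar.map_add_eq_mul, Circle.coe_mul, mul_assoc]

theorem HasFourierFun.const_smul {u : TemperedDistrib K} {g : K → ℂ} (h : F.HasFourierFun u g)
    (c : ℂ) : F.HasFourierFun (c • u) (fun ξ => c * g ξ) := by
  refine ⟨h.1.smul c, fun f => ?_⟩
  change c * F.fourierDistrib u f = _
  rw [h.2, ← integral_const_mul]
  simp only [mul_assoc]

theorem HasFourierFun.affine {u : TemperedDistrib K} {g : K → ℂ} (h : F.HasFourierFun u g)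
    {a : Kˣ} (ha : distribHaarChar K a = ‖(a : K)‖₊) (b : K) :
    F.HasFourierFun (affine u a b) (fun ξ => ((‖(a : K)‖⁻¹ : ℝ) : ℂ) *
      ((F.χ (-((a⁻¹ : Kˣ) * ξ * b)) : ℂ) * g ((a⁻¹ : Kˣ) * ξ))) := by
  have ha' : distribHaarChar K a⁻¹ = ‖((a⁻¹ : Kˣ) : K)‖₊ := by
    rw [map_inv, ha, Units.val_inv_eq_inv_val, nnnorm_inv]
  have hn : (‖(a : K)‖ : ℂ) ≠ 0 := by exact_mod_cast norm_ne_zero_iff.2 a.ne_zero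
  constructor
  · suffices h0 : LocallyIntegrable
        (fun ξ => (F.χ (-((a⁻¹ : Kˣ) * ξ * b)) : ℂ) * g ((a⁻¹ : Kˣ) * ξ)) (haar K) from
      h0.smul (((‖(a : K)‖⁻¹ : ℝ) : ℂ))
    have h1 := locallyIntegrable_comp_mul ha' h.1
    rw [← locallyIntegrableOn_univ] at h1 ⊢
    have : ProperSpace K := ProperSpace.of_locallyCompactSpace K
    refine h1.continuousOn_mul ?_ isOpen_univ.isLocallyClosed
    exact (F.continuous_χ_coe (by fun_prop)).continuousOn
  · intro f
    change ((‖(a : K)‖⁻¹ : ℝ) : ℂ) * u (substTest a b (F.fourierTest f)) = _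
    rw [F.substTest_fourierTest ha, map_smul, smul_eq_mul, ← mul_assoc]
    push_cast
    rw [inv_mul_cancel₀ hn, one_mul]
    have h2 := h.2 (F.modTest a b f)
    change u _ = _ at h2
    rw [h2]
    have h3 := integral_comp_mul ha
      (fun y => ((F.χ (-((a⁻¹ : Kˣ) * y * b)) : ℂ) * g ((a⁻¹ : Kˣ) * y)) * f.1 y)
    simp only [Units.inv_mul_cancel_left] at h3
    simp only [mul_assoc ((‖(a : K)‖ : ℂ)⁻¹)]
    rw [integral_const_mul]
    push_cast at h3
    rw [← h3]
    congr 1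
    ext x
    rw [modTest_apply]
    ring

theorem HasFourierFun.scaled {u : TemperedDistrib K} {g : K → ℂ} (h : F.HasFourierFun u g)
    (j : ℤ) (k : ℕ) :
    F.HasFourierFun (F.scaled u j k) (fun ξ => (((F.q : ℝ) ^ (-(j : ℝ) / 2) : ℝ) : ℂ) *
      ((F.χ (-((F.ϖu ^ j : Kˣ) * ξ * F.lam k)) : ℂ) * g ((F.ϖu ^ j : Kˣ) * ξ))) := by
  have h1 := (h.affine F (F.distribHaarChar_ϖu_zpow (-j)) (F.lam k)).const_smul F
    (((F.q : ℝ) ^ ((j : ℝ) / 2) : ℝ) : ℂ)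
  -- The normalization q^(j/2) meets the Jacobian q⁻ʲ of the dilation.
  have hq : (F.q : ℝ) ^ (-(j : ℝ) / 2) = (F.q : ℝ) ^ ((j : ℝ) / 2) * ((F.q : ℝ) ^ (- -j))⁻¹ := by
    rw [neg_neg, ← zpow_neg, ← Real.rpow_intCast, ← Real.rpow_add F.q_cast_pos]
    congr 1
    push_cast
    ring
  rw [norm_ϖu_zpow, ← zpow_neg, neg_neg (j : ℤ)] at h1
  simp only [← mul_assoc ((((F.q : ℝ) ^ ((j : ℝ) / 2) : ℝ) : ℂ)), ← Complex.ofReal_mul] at h1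
  rw [hq, neg_neg]
  simpa only [LocalFieldData.scaled, zpow_neg, inv_inv] using h1

/-- The factor q in the series is exactly cancelled by the Jacobian of 𝔭⁻¹, so the terms add up to
the expansion of the filter at 𝔭ξ. -/
theorem HasFourierFun.splitTerm {u : TemperedDistrib K} {g : K → ℂ} (h : F.HasFourierFun u g)
    (a : ℕ → ℂ) (k : ℕ) :
    F.HasFourierFun (F.splitTerm a u k) (fun ξ => a k *
      (conj (F.χ (F.lam k * (F.ϖ * ξ)) : ℂ) * g (F.ϖ * ξ))) := by
  have h0 := F.distribHaarChar_ϖu_zpow (-1)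
  rw [zpow_neg_one] at h0
  have h1 := (h.affine F h0 (F.lam k)).const_smul F ((F.q : ℂ) * a k)
  have hq : (F.q : ℂ) ≠ 0 := by exact_mod_cast F.q_pos.ne'
  refine (congrArg (F.HasFourierFun _) (funext fun ξ => ?_)).mpr h1
  rw [show ‖((F.ϖu⁻¹ : Kˣ) : K)‖ = F.q from F.norm_inv_ϖ, inv_inv, χ_neg_coe,
    show ((F.ϖu : Kˣ) : K) = F.ϖ from rfl, mul_comm (F.lam k)]
  push_cast
  field_simp

end Affine

/-! ### Convergence of the splitting series in the space of distributions. -/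

section Splitting

variable {K : Type*} [NontriviallyNormedField K] [IsUltrametricDist K] [LocallyCompactSpace K]
  (F : LocalFieldData K) [MeasurableSpace K] [BorelSpace K]

theorem integrableOn_closedBall_add_iff {E : Type*} [NormedAddCommGroup E]
    {f : K → E} {b : K} {r : ℝ} :
    IntegrableOn (fun x => f (x + b)) (Metric.closedBall 0 r) (haar K) ↔
      IntegrableOn f (Metric.closedBall b r) (haar K) := by
  have h := (measurePreserving_add_right (haar K) b).integrableOn_comp_preimage
    (measurableEmbedding_addRight b) (f := f) (s := Metric.closedBall b r)
  rwa [preimage_closedBall_add] at h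

theorem locallyIntegrable_of_forall_lam {f : K → ℂ}
    (hf : ∀ i, IntegrableOn (fun x => f (x + F.lam i)) (Metric.closedBall 0 1) (haar K)) :
    LocallyIntegrable f (haar K) := by
  intro x
  obtain ⟨k, hk⟩ := F.exists_lam_closedBall x
  refine ⟨Metric.closedBall (F.lam k) 1, ?_, integrableOn_closedBall_add_iff.1 (hf k)⟩
  exact (IsUltrametricDist.isOpen_closedBall _ one_ne_zero).mem_nhds
    (mem_closedBall_iff_norm.2 hk)

theorem integral_eq_sum_lam {f : K → ℂ} {N : ℕ} (h0 : ∀ x, (F.q : ℝ) ^ N < ‖x‖ → f x = 0)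
    (hf : ∀ i, IntegrableOn (fun x => f (x + F.lam i)) (Metric.closedBall 0 1) (haar K)) :
    ∫ x, f x ∂(haar K) = ∑ i ∈ Finset.range (F.q ^ N),
      ∫ x in Metric.closedBall 0 1, f (x + F.lam i) ∂(haar K) := by
  have h1 : ∀ x ∉ ⋃ i ∈ Finset.range (F.q ^ N), Metric.closedBall (F.lam i) 1, f x = 0 := by
    intro x hx
    refine h0 x (not_le.1 fun hle => hx ?_)
    obtain ⟨k, hk, hd⟩ := F.exists_lam N x hle
    exact Set.mem_iUnion₂.2 ⟨k, Finset.mem_range.2 hk, mem_closedBall_iff_norm.2 hd⟩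
  rw [← setIntegral_eq_integral_of_forall_compl_eq_zero h1, integral_biUnion_finset]
  · exact Finset.sum_congr rfl fun i _ => setIntegral_closedBall_add f _ _
  · exact fun _ _ => measurableSet_closedBall
  · exact fun i _ j _ hij => F.pairwise_disjoint_closedBall_lam hij
  · exact fun i _ => integrableOn_closedBall_add_iff.1 (hf i)

/-- The restriction of the Haar measure to the unit ball. -/
abbrev haarBall (K : Type*) [NontriviallyNormedField K] [LocallyCompactSpace K]
    [MeasurableSpace K] [BorelSpace K] : Measure K :=
  (haar K).restrict (Metric.closedBall 0 1)

instance : IsFiniteMeasure (haarBall K) :=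
  ⟨by rw [Measure.restrict_apply_univ, haar_unitBall]; exact ENNReal.one_lt_top⟩

theorem memLp_χ (c : K) : MemLp (fun η => conj (F.χ (c * η) : ℂ)) 2 (haarBall K) := by
  have : ProperSpace K := ProperSpace.of_locallyCompactSpace K
  have hc : Continuous fun η : K => conj (F.χ (c * η) : ℂ) :=
    Complex.continuous_conj.comp (F.continuous_χ_coe (by fun_prop))
  refine MemLp.of_bound hc.aestronglyMeasurable 1 (Eventually.of_forall fun x => ?_)
  rw [RCLike.norm_conj]
  exact (Circle.norm_coe _).le

/-- The functions `conj χₖ` as elements of `L²(D)`. -/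
def expLp (k : ℕ) : Lp ℂ 2 (haarBall K) := (F.memLp_χ (F.lam k)).toLp _

theorem orthonormal_expLp : Orthonormal ℂ F.expLp := by
  rw [orthonormal_iff_ite]
  intro k l
  rw [L2.inner_def]
  have h1 : ∀ᵐ η ∂(haarBall K), inner ℂ (F.expLp k η) (F.expLp l η) =
      (F.χ ((F.lam k - F.lam l) * η) : ℂ) := by
    filter_upwards [(F.memLp_χ (F.lam k)).coeFn_toLp, (F.memLp_χ (F.lam l)).coeFn_toLp] with η hk hl
    rw [expLp, expLp, hk, hl, RCLike.inner_apply, Complex.conj_conj, mul_comm, ← χ_neg_coe,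
      ← Circle.coe_mul, ← AddChar.map_add_eq_mul]
    congr 2
    ring
  rw [integral_congr_ae h1, integral_χ_unitBall]
  refine if_congr ⟨F.lam_injective, ?_⟩ rfl rfl
  rintro rfl
  simp

/-- A series `∑ aₖ conj χₖ` with square summable coefficients that converges to `m` in `L²(D)`
may be integrated term by term against `L²` functions. -/
theorem hasSum_integral_filter {a : ℕ → ℂ} (ha : Summable fun k => ‖a k‖ ^ 2) {m : K → ℂ}
    (hm : MemLp m 2 (haarBall K))
    (hlim : Tendsto (fun N : ℕ => eLpNorm
      (fun ξ => m ξ - ∑ k ∈ Finset.range N, a k * conj (F.χ (F.lam k * ξ) : ℂ)) 2 (haarBall K))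
      atTop (𝓝 0)) {G : K → ℂ} (hG : MemLp G 2 (haarBall K)) :
    HasSum (fun k => a k * ∫ η, conj (F.χ (F.lam k * η) : ℂ) * G η ∂(haarBall K))
      (∫ η, m η * G η ∂(haarBall K)) := by
  have hs : Summable fun k => a k • F.expLp k := by
    have h := F.orthonormal_expLp.orthogonalFamily.summable_iff_norm_sq_summable a
    simpa using h.2 ha
  have hpart : ∀ N : ℕ, ∑ k ∈ Finset.range N, a k • F.expLp k =
      (memLp_finsetSum (Finset.range N) fun k _ =>
        (F.memLp_χ (F.lam k)).const_mul (a k)).toLp _ := by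
    intro N
    induction N with
    | zero => simp only [Finset.range_zero, Finset.sum_empty]; exact (MemLp.toLp_zero _).symm
    | succ N ih =>
      rw [Finset.sum_range_succ, ih, expLp, ← MemLp.toLp_const_smul, ← MemLp.toLp_add]
      refine MemLp.toLp_congr _ _ (Eventually.of_forall fun x => ?_)
      simp [Finset.sum_range_succ]
  -- Orthonormality gives unconditional convergence; the assumed limit of the initial partial sums
  -- then identifies the sum as m.
  have hS : HasSum (fun k => a k • F.expLp k) (hm.toLp m) := by
    convert hs.hasSum using 1
    refine tendsto_nhds_unique ?_ hs.hasSum.tendsto_sum_nat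
    rw [tendsto_iff_edist_tendsto_0]
    refine hlim.congr fun N => ?_
    rw [edist_comm, hpart, Lp.edist_toLp_toLp]
    refine eLpNorm_congr_ae (Eventually.of_forall fun x => ?_)
    simp
  have hGc : MemLp (fun η => conj (G η)) 2 (haarBall K) := hG.star
  have h1 := (innerSL ℂ (hGc.toLp _)).hasSum hS
  have key : ∀ (H : K → ℂ) (hH : MemLp H 2 (haarBall K)),
      innerSL ℂ (hGc.toLp _) (hH.toLp H) = ∫ η, H η * G η ∂(haarBall K) := by
    intro H hH
    rw [innerSL_apply_apply, L2.inner_def]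
    refine integral_congr_ae ?_
    filter_upwards [hGc.coeFn_toLp, hH.coeFn_toLp] with η h2 h3
    rw [h2, h3, RCLike.inner_apply, Complex.conj_conj]
  rw [key] at h1
  have h2 : (fun k => innerSL ℂ (hGc.toLp _) (a k • F.expLp k)) =
      fun k => a k * ∫ η, conj (F.χ (F.lam k * η) : ℂ) * G η ∂(haarBall K) :=
    funext fun k => by rw [map_smul, expLp, key, smul_eq_mul]
  rw [h2] at h1
  exact h1

theorem χ_lam_mul_add_lam (k i : ℕ) (x : K) :
    F.χ (F.lam k * (x + F.lam i)) = F.χ (F.lam k * x) := by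
  rw [mul_add, AddChar.map_add_eq_mul, χ_lam_mul_lam, mul_one]

/-- Term by term integration of a filter against a function on `K` with bounded support. -/
theorem hasSum_integral_filter_of_support {a : ℕ → ℂ} (ha : Summable fun k => ‖a k‖ ^ 2)
    {m : K → ℂ} (hm : MemLp m 2 (haarBall K)) (hper : ∀ (k : ℕ) (ξ : K), m (ξ + F.lam k) = m ξ)
    (hlim : Tendsto (fun N : ℕ => eLpNorm
      (fun ξ => m ξ - ∑ k ∈ Finset.range N, a k * conj (F.χ (F.lam k * ξ) : ℂ)) 2 (haarBall K))
      atTop (𝓝 0)) {G : K → ℂ} {N : ℕ} (h0 : ∀ x, (F.q : ℝ) ^ N < ‖x‖ → G x = 0)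
    (hG : ∀ i, MemLp (fun x => G (x + F.lam i)) 2 (haarBall K)) :
    HasSum (fun k => a k * ∫ η, conj (F.χ (F.lam k * η) : ℂ) * G η ∂(haar K))
      (∫ η, m η * G η ∂(haar K)) := by
  -- Both m and the conj χₖ are λ-periodic, so integrals against G fold into finitely many integrals
  -- over D.
  have h1 : ∀ (H : K → ℂ), MemLp H 2 (haarBall K) → (∀ i x, H (x + F.lam i) = H x) →
      ∫ η, H η * G η ∂(haar K) = ∑ i ∈ Finset.range (F.q ^ N),
        ∫ x, H x * G (x + F.lam i) ∂(haarBall K) := by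
    intro H hH hHp
    have h2 := F.integral_eq_sum_lam (f := fun η => H η * G η)
      (fun x hx => by rw [h0 x hx, mul_zero]) (fun i => by
        simp only [hHp]
        exact hH.integrable_mul (hG i))
    simpa only [hHp] using h2
  rw [h1 m hm fun i x => hper i x]
  have h3 : (fun k => a k * ∫ η, conj (F.χ (F.lam k * η) : ℂ) * G η ∂(haar K)) = fun k =>
      ∑ i ∈ Finset.range (F.q ^ N), a k * ∫ x, conj (F.χ (F.lam k * x) : ℂ) * G (x + F.lam i)
        ∂(haarBall K) := by
    ext k
    rw [h1 _ (F.memLp_χ (F.lam k)) fun i x => by rw [χ_lam_mul_add_lam], Finset.mul_sum]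
  rw [h3]
  exact hasSum_sum fun i _ => F.hasSum_integral_filter ha hm hlim (hG i)

/-- The distribution whose Fourier transform is the locally integrable function `G`. -/
def ofFourierFun (G : K → ℂ) (hG : LocallyIntegrable G (haar K)) : TemperedDistrib K where
  toFun f := ∫ ξ, G ξ * (F.invFourierTest f).1 ξ ∂(haar K)
  map_add' f g := by
    rw [map_add, ← integral_add (integrable_mul_testFun hG _) (integrable_mul_testFun hG _)]
    simp only [← mul_add]
    rfl
  map_smul' c f := by
    rw [map_smul, RingHom.id_apply, smul_eq_mul, ← integral_const_mul]
    simp only [mul_left_comm c]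
    rfl

theorem hasFourierFun_ofFourierFun {G : K → ℂ} (hG : LocallyIntegrable G (haar K)) :
    F.HasFourierFun (F.ofFourierFun G hG) G := by
  refine ⟨hG, fun f => ?_⟩
  change ∫ ξ, G ξ * (F.invFourierTest (F.fourierTest f)).1 ξ ∂(haar K) = _
  rw [invFourierTest_fourierTest]

theorem HasFourierFun.eq_ofFourierFun {u : TemperedDistrib K} {G : K → ℂ}
    (hG : LocallyIntegrable G (haar K)) (h : F.HasFourierFun u G) : u = F.ofFourierFun G hG :=
  F.fourierDistrib_injective fun f => by rw [h.2, (F.hasFourierFun_ofFourierFun hG).2]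

theorem locallyIntegrable_filter_mul {m g : K → ℂ} (hm : MemLp m 2 (haarBall K))
    (hper : ∀ (k : ℕ) (ξ : K), m (ξ + F.lam k) = m ξ)
    (hg : ∀ i, MemLp (fun x => g (x + F.lam i)) 2 (haarBall K)) :
    LocallyIntegrable (fun ξ => m (F.ϖ * ξ) * g (F.ϖ * ξ)) (haar K) := by
  have h0 := F.distribHaarChar_ϖu_zpow 1
  rw [zpow_one] at h0
  refine locallyIntegrable_comp_mul (f := fun ξ => m ξ * g ξ) h0 ?_
  refine F.locallyIntegrable_of_forall_lam fun i => ?_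
  simp only [hper]
  exact hm.integrable_mul (hg i)

/-- A test function is the Fourier transform of some h, so each pairing is an integral against h on
the Fourier side. After η = 𝔭ξ it becomes the pairing of the filter series with G(η) = g(η) h(𝔭⁻¹η),
which has bounded support and is locally L². -/
theorem hasDistSum_splitTerm {a : ℕ → ℂ} (ha : Summable fun k => ‖a k‖ ^ 2)
    {m : K → ℂ} (hm : MemLp m 2 (haarBall K)) (hper : ∀ (k : ℕ) (ξ : K), m (ξ + F.lam k) = m ξ)
    (hlim : Tendsto (fun N : ℕ => eLpNorm
      (fun ξ => m ξ - ∑ k ∈ Finset.range N, a k * conj (F.χ (F.lam k * ξ) : ℂ)) 2 (haarBall K))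
      atTop (𝓝 0)) {u : TemperedDistrib K} {g : K → ℂ} (hu : F.HasFourierFun u g)
    (hg : ∀ i, MemLp (fun x => g (x + F.lam i)) 2 (haarBall K)) :
    HasDistSum (F.splitTerm a u) (F.ofFourierFun _ (F.locallyIntegrable_filter_mul hm hper hg)) := by
  intro f
  have h0 := F.distribHaarChar_ϖu_zpow 1
  rw [zpow_one] at h0
  rw [← F.fourierTest_invFourierTest f]
  set h := F.invFourierTest f with hh
  have hϖ := F.ϖ_ne_zero
  set G : K → ℂ := fun η => g η * h.1 (F.ϖ⁻¹ * η) with hGdef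
  have hcov : ∀ H : K → ℂ, ∫ ξ, H (F.ϖ * ξ) * g (F.ϖ * ξ) * h.1 ξ ∂(haar K) =
      ((‖F.ϖ‖⁻¹ : ℝ) : ℂ) * ∫ η, H η * G η ∂(haar K) := by
    intro H
    refine Eq.trans ?_ (integral_comp_mul h0 fun η => H η * G η)
    congr 1
    ext ξ
    rw [hGdef, show ((F.ϖu : Kˣ) : K) = F.ϖ from rfl]
    simp only [inv_mul_cancel_left₀ hϖ, mul_assoc]
  obtain ⟨R, hR⟩ := h.2.2.isCompact.isBounded.subset_closedBall (0 : K)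
  obtain ⟨N, hN⟩ := pow_unbounded_of_one_lt R (show (1 : ℝ) < F.q by exact_mod_cast F.one_lt_q)
  have hsupp : ∀ x, (F.q : ℝ) ^ N < ‖x‖ → G x = 0 := by
    intro x hx
    have h1 : h.1 (F.ϖ⁻¹ * x) = 0 := by
      refine image_eq_zero_of_notMem_tsupport fun hx' => ?_
      have h2 := hR hx'
      rw [mem_closedBall_zero_iff, norm_mul, norm_inv_ϖ] at h2
      have h3 : ‖x‖ ≤ F.q * ‖x‖ :=
        le_mul_of_one_le_left (norm_nonneg _) (by exact_mod_cast F.one_lt_q.le)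
      linarith
    rw [hGdef]
    simp only [h1, mul_zero]
  have hGmem : ∀ i, MemLp (fun x => G (x + F.lam i)) 2 (haarBall K) := by
    intro i
    obtain ⟨C, hC⟩ := h.2.2.exists_bound_of_continuous h.2.1.continuous
    have : ProperSpace K := ProperSpace.of_locallyCompactSpace K
    have hc : Continuous fun x : K => h.1 (F.ϖ⁻¹ * (x + F.lam i)) :=
      h.2.1.continuous.comp (by fun_prop)
    refine (hg i).of_le_mul (c := C) ((hg i).1.mul hc.aestronglyMeasurable)
      (Eventually.of_forall fun x => ?_)
    change ‖g (x + F.lam i) * h.1 (F.ϖ⁻¹ * (x + F.lam i))‖ ≤ _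
    rw [norm_mul, mul_comm]
    exact mul_le_mul_of_nonneg_right (hC _) (norm_nonneg _)
  have hmain := (F.hasSum_integral_filter_of_support ha hm hper hlim hsupp hGmem).mul_left
    ((‖F.ϖ‖⁻¹ : ℝ) : ℂ)
  rw [← hcov] at hmain
  have hloc := F.locallyIntegrable_filter_mul hm hper hg
  have hlimval := (F.hasFourierFun_ofFourierFun hloc).2 h
  change F.ofFourierFun _ hloc (F.fourierTest h) = _ at hlimval
  rw [hlimval]
  have hterm : (fun k => F.splitTerm a u k (F.fourierTest h)) = fun k => ((‖F.ϖ‖⁻¹ : ℝ) : ℂ) *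
      (a k * ∫ η, conj (F.χ (F.lam k * η) : ℂ) * G η ∂(haar K)) := by
    ext k
    have hk := (hu.splitTerm F a k).2 h
    change F.splitTerm a u k (F.fourierTest h) = _ at hk
    rw [hk, mul_left_comm, ← hcov, ← integral_const_mul]
    simp only [mul_assoc]
  rw [hterm]
  exact hmain

theorem HasDistSum.unique {u : ℕ → TemperedDistrib K} {v v' : TemperedDistrib K}
    (h : HasDistSum u v) (h' : HasDistSum u v') : v = v' :=
  LinearMap.ext fun f => (h f).unique (h' f)

theorem HasDistSum.distSum_eq {u : ℕ → TemperedDistrib K} {v : TemperedDistrib K}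
    (h : HasDistSum u v) : distSum u = v := by
  have hex : ∃ v, HasDistSum u v := ⟨v, h⟩
  rw [distSum, dif_pos hex]
  exact HasDistSum.unique hex.choose_spec h

end Splitting

/-! ### Periodization over the points λ(k). -/

section Periodization

open scoped ENNReal

variable {K : Type*} [NontriviallyNormedField K] [IsUltrametricDist K] [LocallyCompactSpace K]
  (F : LocalFieldData K) [MeasurableSpace K] [BorelSpace K]

theorem integrable_haarBall_add {E : Type*} [NormedAddCommGroup E] {f : K → E}
    (hf : Integrable f (haar K)) (b : K) : Integrable (fun η => f (η + b)) (haarBall K) :=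
  (integrableOn_closedBall_add_iff (f := f) (b := b)).2 hf.integrableOn

/-- By Tonelli, the sum of the absolute values has finite integral over D. -/
theorem ae_summable_lam {f : K → ℂ} (hf : Integrable f (haar K)) :
    ∀ᵐ η ∂(haarBall K), Summable fun k => f (η + F.lam k) := by
  have h1 : ∫⁻ η, ∑' k, ‖f (η + F.lam k)‖ₑ ∂(haarBall K) ≠ ∞ := by
    rw [lintegral_tsum fun k => (integrable_haarBall_add hf _).1.enorm,
        ← F.lintegral_eq_tsum_lam fun x => ‖f x‖ₑ]
    exact hf.2.ne
  have h2 := ae_lt_top' (AEMeasurable.tsum fun k =>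
    (integrable_haarBall_add hf (F.lam k)).1.enorm) h1
  filter_upwards [h2] with η hη
  refine Summable.of_norm ?_
  have h3 := ENNReal.tsum_coe_ne_top_iff_summable.1 hη.ne
  exact NNReal.summable_coe.2 h3

theorem integrable_tsum_lam {f : K → ℂ} (hf : Integrable f (haar K)) :
    Integrable (fun η => ∑' k, f (η + F.lam k)) (haarBall K) := by
  constructor
  · refine aestronglyMeasurable_of_tendsto_ae atTop (f := fun N : ℕ => fun η =>
      ∑ k ∈ Finset.range N, f (η + F.lam k)) (fun N => ?_) ?_
    · exact Finset.aestronglyMeasurable_fun_sum _ fun k _ => (integrable_haarBall_add hf _).1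
    · filter_upwards [F.ae_summable_lam hf] with η hη
      exact hη.hasSum.tendsto_sum_nat
  · have h1 : ∫⁻ η, ∑' k, ‖f (η + F.lam k)‖ₑ ∂(haarBall K) < ∞ := by
      rw [lintegral_tsum fun k => (integrable_haarBall_add hf _).1.enorm,
        ← F.lintegral_eq_tsum_lam fun x => ‖f x‖ₑ]
      exact hf.2
    refine lt_of_le_of_lt (lintegral_mono fun η => ?_) h1
    exact enorm_tsum_le_tsum_enorm

theorem integral_eq_integral_tsum_lam {f : K → ℂ} (hf : Integrable f (haar K)) :
    ∫ x, f x ∂(haar K) = ∫ η, ∑' k, f (η + F.lam k) ∂(haarBall K) :=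
  (F.hasSum_integral_lam hf).unique (hasSum_integral_of_summable_integral_norm
    (fun _ => integrable_haarBall_add hf _) (F.hasSum_integral_lam hf.norm).summable)

theorem χ_mul_add_lam {c : K} (hc : ∀ k, F.χ (c * F.lam k) = 1) (k : ℕ) (x : K) :
    F.χ (c * (x + F.lam k)) = F.χ (c * x) := by
  rw [mul_add, AddChar.map_add_eq_mul, hc, mul_one]

theorem integrable_χ_mul {f : K → ℂ} (hf : Integrable f (haar K)) (c : K) :
    Integrable (fun x => (F.χ (c * x) : ℂ) * f x) (haar K) := by
  have : ProperSpace K := ProperSpace.of_locallyCompactSpace K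
  refine hf.bdd_mul (c := 1) (F.continuous_χ_coe (by fun_prop)).aestronglyMeasurable
    (Eventually.of_forall fun x => (Circle.norm_coe _).le)

theorem integral_χ_mul_of_hasSum {f : K → ℂ} (hf : Integrable f (haar K)) {z : K}
    {b : ℂ} (hc : ∀ k, F.χ (z * F.lam k) = 1)
    (h : ∀ᵐ η ∂(haarBall K), HasSum (fun k => f (η + F.lam k)) b) :
    ∫ x, (F.χ (z * x) : ℂ) * f x ∂(haar K) = if ‖z‖ ≤ 1 then b else 0 := by
  rw [F.integral_eq_integral_tsum_lam (F.integrable_χ_mul hf z)]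
  have h1 : ∀ᵐ η ∂(haarBall K), ∑' k, (F.χ (z * (η + F.lam k)) : ℂ) * f (η + F.lam k) =
      (F.χ (z * η) : ℂ) * b := by
    filter_upwards [h] with η hη
    simp only [F.χ_mul_add_lam hc, tsum_mul_left, hη.tsum_eq]
  rw [integral_congr_ae h1, integral_mul_const, integral_χ_unitBall, ite_mul, one_mul, zero_mul]

/-- The converse of `integral_χ_mul_of_hasSum`: folding shows that the periodization minus 1, cut
off to D, is orthogonal to every χ(λ(l)·). On D every character χ(y·) agrees with one of these, so
the difference vanishes. -/
theorem ae_hasSum_of_integral_χ {f : K → ℂ} (hf : Integrable f (haar K))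
    (h : ∀ l, ∫ x, (F.χ (F.lam l * x) : ℂ) * f x ∂(haar K) = if l = 0 then 1 else 0) :
    ∀ᵐ η ∂(haarBall K), HasSum (fun k => f (η + F.lam k)) 1 := by
  set Q : K → ℂ := fun η => ∑' k, f (η + F.lam k) with hQ
  have hQi : Integrable Q (haarBall K) := F.integrable_tsum_lam hf
  have hone : Integrable (fun _ : K => (1 : ℂ)) (haarBall K) := integrable_const _
  have hint : Integrable ((Metric.closedBall (0 : K) 1).indicator fun η => Q η - 1) (haar K) :=
    IntegrableOn.integrable_indicator (hQi.sub hone) measurableSet_closedBall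
  have hχi : ∀ (y : K) {k : K → ℂ}, Integrable k (haarBall K) →
      Integrable (fun η => (F.χ (y * η) : ℂ) * k η) (haarBall K) := by
    intro y k hk
    have : ProperSpace K := ProperSpace.of_locallyCompactSpace K
    exact hk.bdd_mul (c := 1) (F.continuous_χ_coe (by fun_prop)).aestronglyMeasurable
      (Eventually.of_forall fun x => (Circle.norm_coe _).le)
  have hzero := F.ae_eq_zero_of_forall_integral_χ hint fun y => by
    obtain ⟨l, hl⟩ := F.exists_lam_closedBall y
    have h1 : ∀ x ∈ Metric.closedBall (0 : K) 1, F.χ (y * x) = F.χ (F.lam l * x) := by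
      intro x hx
      rw [show y * x = (y - F.lam l) * x + F.lam l * x by ring, AddChar.map_add_eq_mul,
        F.χ_trivial, one_mul]
      rw [norm_mul]
      exact mul_le_one₀ hl (norm_nonneg _) (by simpa using hx)
    have h2 : ∀ x, (F.χ (y * x) : ℂ) * (Metric.closedBall (0 : K) 1).indicator
        (fun η => Q η - 1) x = (Metric.closedBall (0 : K) 1).indicator
          (fun η => (F.χ (F.lam l * η) : ℂ) * Q η - (F.χ (F.lam l * η) : ℂ) * 1) x := by
      intro x
      by_cases hx : x ∈ Metric.closedBall (0 : K) 1
      · rw [Set.indicator_of_mem hx, Set.indicator_of_mem hx, h1 x hx, mul_sub]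
      · rw [Set.indicator_of_notMem hx, Set.indicator_of_notMem hx, mul_zero]
    simp only [h2]
    rw [integral_indicator measurableSet_closedBall, integral_sub (hχi _ hQi) (hχi _ hone)]
    simp only [mul_one]
    rw [integral_χ_unitBall, sub_eq_zero]
    have h3 := F.integral_eq_integral_tsum_lam (F.integrable_χ_mul hf (F.lam l))
    simp only [F.χ_mul_add_lam (F.χ_lam_mul_lam l), tsum_mul_left] at h3
    rw [← h3, h]
    refine if_congr ⟨?_, fun hn => ?_⟩ rfl rfl
    · rintro rfl
      simp [lam_zero]
    · exact F.lam_injective (by rwa [lam_zero, sub_zero])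
  have hzero' := (ae_restrict_iff' (measurableSet_closedBall (x := (0 : K)) (ε := 1))).2
    (hzero.mono fun x hx (hxb : x ∈ Metric.closedBall (0 : K) 1) => by
      rw [Set.indicator_of_mem hxb] at hx
      exact sub_eq_zero.1 hx)
  filter_upwards [hzero', F.ae_summable_lam hf] with η h1 h2
  rw [← h1]
  exact h2.hasSum

end Periodization

/-! ### Sobolev inner products through periodized densities, and the action of a filter bank. -/

section Sobolev

open scoped ENNReal

variable {K : Type*} [NontriviallyNormedField K] [IsUltrametricDist K] [LocallyCompactSpace K]
  (F : LocalFieldData K)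

/-- The Sobolev weight `(1 + |ξ|²)ˢ` in the variable `𝔭ʲ ξ`. -/
def weight (s : ℝ) (j : ℤ) (η : K) : ℝ := (1 + ‖((F.ϖu ^ (-j) : Kˣ) : K) * η‖ ^ 2) ^ s

theorem weight_pos (s : ℝ) (j : ℤ) (η : K) : 0 < F.weight s j η :=
  Real.rpow_pos_of_pos (by positivity) _

theorem continuous_weight (s : ℝ) (j : ℤ) : Continuous (F.weight s j) :=
  Continuous.rpow_const (by fun_prop) fun η =>
    Or.inl (ne_of_gt (by positivity : 0 < 1 + ‖((F.ϖu ^ (-j) : Kˣ) : K) * η‖ ^ 2))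

theorem weight_zpow_mul (s : ℝ) (j : ℤ) (ξ : K) :
    F.weight s j ((F.ϖu ^ j : Kˣ) * ξ) = (1 + ‖ξ‖ ^ 2) ^ s := by
  rw [weight, ← mul_assoc, ← Units.val_mul, ← zpow_add, neg_add_cancel, zpow_zero, Units.val_one,
    one_mul]

theorem weight_succ_mul (s : ℝ) (j : ℤ) (ξ : K) :
    F.weight s (j + 1) (F.ϖ * ξ) = F.weight s j ξ := by
  have h : ((F.ϖu ^ (-(j + 1)) : Kˣ) : K) * (F.ϖ * ξ) = ((F.ϖu ^ (-j) : Kˣ) : K) * ξ := by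
    rw [← mul_assoc, show F.ϖ = ((F.ϖu ^ (1 : ℤ) : Kˣ) : K) by rw [zpow_one]; rfl,
      ← Units.val_mul, ← zpow_add]
    congr 3
    ring
  rw [weight, weight, h]

variable [MeasurableSpace K] [BorelSpace K]

/-- The density of the Sobolev inner product at level `j`. -/
def density (s : ℝ) (j : ℤ) (g h : K → ℂ) (η : K) : ℂ :=
  (F.weight s j η : ℂ) * (g η * conj (h η))

theorem density_self (s : ℝ) (j : ℤ) (g : K → ℂ) (η : K) :
    F.density s j g g η = ((F.weight s j η * ‖g η‖ ^ 2 : ℝ) : ℂ) := by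
  rw [density, RCLike.mul_conj]
  push_cast
  rfl

/-- Biorthogonality of the integer translates, in terms of the Fourier transforms: the
periodization of the density is the constant `b`. -/
def HasPeriodization (s : ℝ) (j : ℤ) (g h : K → ℂ) (b : ℂ) : Prop :=
  ∀ᵐ η ∂(haarBall K), HasSum (fun k => F.density s j g h (η + F.lam k)) b

theorem aestronglyMeasurable_density {s : ℝ} {j : ℤ} {g h : K → ℂ}
    (hg : AEStronglyMeasurable g (haar K)) (hh : AEStronglyMeasurable h (haar K)) :
    AEStronglyMeasurable (F.density s j g h) (haar K) := by
  have : ProperSpace K := ProperSpace.of_locallyCompactSpace K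
  have hw : Continuous fun η => (F.weight s j η : ℂ) :=
    Complex.continuous_ofReal.comp (F.continuous_weight s j)
  exact hw.aestronglyMeasurable.mul (hg.mul (Complex.continuous_conj.comp_aestronglyMeasurable hh))

/-- The diagonal density is nonnegative, so by Tonelli its integral over K is that of the constant 1
over D. -/
theorem HasPeriodization.integrable {s : ℝ} {j : ℤ} {g : K → ℂ}
    (hg : AEStronglyMeasurable g (haar K)) (h : F.HasPeriodization s j g g 1) :
    Integrable (F.density s j g g) (haar K) := by
  refine ⟨F.aestronglyMeasurable_density hg hg, ?_⟩
  have hm : ∀ k, AEMeasurable (fun η => ‖F.density s j g g (η + F.lam k)‖ₑ) (haarBall K) := by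
    intro k
    have h1 := (F.aestronglyMeasurable_density (s := s) (j := j) hg hg).comp_quasiMeasurePreserving
      (measurePreserving_add_right (haar K) (F.lam k)).quasiMeasurePreserving
    exact (h1.mono_measure Measure.restrict_le_self).enorm
  rw [HasFiniteIntegral, F.lintegral_eq_tsum_lam, ← lintegral_tsum hm]
  have h2 : ∀ᵐ η ∂(haarBall K), ∑' k, ‖F.density s j g g (η + F.lam k)‖ₑ = 1 := by
    filter_upwards [h] with η hη
    simp only [density_self] at hη ⊢
    rw [← Complex.ofReal_one, Complex.hasSum_ofReal] at hη
    have hnn : ∀ k, 0 ≤ F.weight s j (η + F.lam k) * ‖g (η + F.lam k)‖ ^ 2 :=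
      fun k => mul_nonneg (F.weight_pos _ _ _).le (sq_nonneg _)
    have h3 := ENNReal.ofReal_tsum_of_nonneg hnn hη.summable
    rw [hη.tsum_eq, ENNReal.ofReal_one] at h3
    rw [h3]
    refine tsum_congr fun k => ?_
    rw [← ofReal_norm, Complex.norm_real, Real.norm_of_nonneg (hnn k)]
  rw [lintegral_congr_ae h2, lintegral_one]
  exact measure_lt_top _ _

theorem integrable_density {s : ℝ} {j : ℤ} {g h : K → ℂ}
    (hg : AEStronglyMeasurable g (haar K)) (hh : AEStronglyMeasurable h (haar K))
    (hgi : Integrable (F.density s j g g) (haar K))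
    (hhi : Integrable (F.density s j h h) (haar K)) :
    Integrable (F.density s j g h) (haar K) := by
  refine (hgi.norm.add hhi.norm).mono' (F.aestronglyMeasurable_density hg hh)
    (Eventually.of_forall fun η => ?_)
  have hw := F.weight_pos s j η
  simp only [Pi.add_apply, density, norm_mul, RCLike.norm_conj, Complex.norm_real,
    Real.norm_of_nonneg hw.le]
  nlinarith [mul_nonneg hw.le (sq_nonneg (‖g η‖ - ‖h η‖)), mul_nonneg hw.le (sq_nonneg ‖g η‖),
    mul_nonneg hw.le (sq_nonneg ‖h η‖)]

/-- The weight is continuous and positive, so its inverse is bounded on compact balls, whatever the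
sign of s. -/
theorem memLp_add_lam_of_integrable {s : ℝ} {j : ℤ} {g : K → ℂ}
    (hg : AEStronglyMeasurable g (haar K)) (hgi : Integrable (F.density s j g g) (haar K))
    (b : K) : MemLp (fun x => g (x + b)) 2 (haarBall K) := by
  have : ProperSpace K := ProperSpace.of_locallyCompactSpace K
  have h1 : AEStronglyMeasurable (fun x => g (x + b)) (haarBall K) :=
    (hg.comp_quasiMeasurePreserving
      (measurePreserving_add_right (haar K) b).quasiMeasurePreserving).mono_measure
        Measure.restrict_le_self
  rw [memLp_two_iff_integrable_sq_norm h1]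
  refine (integrableOn_closedBall_add_iff (f := fun x => ‖g x‖ ^ 2) (b := b) (r := 1)).2 ?_
  have hw : ContinuousOn (fun x => (F.weight s j x)⁻¹) (Metric.closedBall b 1) :=
    ((F.continuous_weight s j).inv₀ fun x => (F.weight_pos s j x).ne').continuousOn
  have h2 := (hgi.norm.integrableOn (s := Metric.closedBall b 1)).continuousOn_mul hw
    (isCompact_closedBall _ _)
  refine h2.congr_fun (fun x _ => ?_) measurableSet_closedBall
  have hp := F.weight_pos s j x
  simp only [density_self, Complex.norm_real]
  rw [Real.norm_of_nonneg (mul_nonneg hp.le (sq_nonneg _)), inv_mul_cancel_left₀ hp.ne']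

theorem integral_χ_mul_density {s : ℝ} {j : ℤ} {g h : K → ℂ}
    (hi : Integrable (F.density s j g h) (haar K)) {b : ℂ} (hp : F.HasPeriodization s j g h b)
    (k l : ℕ) : ∫ η, (F.χ ((F.lam l - F.lam k) * η) : ℂ) * F.density s j g h η ∂(haar K) =
      if k = l then b else 0 := by
  rw [F.integral_χ_mul_of_hasSum hi (fun i => ?_) hp]
  · refine if_congr ⟨fun hn => (F.lam_injective hn).symm, ?_⟩ rfl rfl
    rintro rfl
    simp
  · rw [sub_mul, AddChar.map_sub_eq_div, χ_lam_mul_lam, χ_lam_mul_lam, div_one]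

theorem rpow_neg_half_mul_self (j : ℤ) :
    (F.q : ℝ) ^ (-(j : ℝ) / 2) * (F.q : ℝ) ^ (-(j : ℝ) / 2) = (F.q : ℝ) ^ (-j) := by
  rw [← Real.rpow_add F.q_cast_pos, ← Real.rpow_intCast]
  congr 1
  push_cast
  ring

/-- Substitute η = 𝔭ʲξ: the two factors q^(-j/2) absorb the Jacobian, and the two translations
combine into one character. -/
theorem sobolevInner_scaled {s : ℝ} {u v : TemperedDistrib K} {g h : K → ℂ}
    (hu : F.HasFourierFun u g) (hv : F.HasFourierFun v h) (j : ℤ) (k l : ℕ) :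
    F.sobolevInner s (F.scaled u j k) (F.scaled v j l) =
      ∫ η, (F.χ ((F.lam l - F.lam k) * η) : ℂ) * F.density s j g h η ∂(haar K) := by
  have hq := F.q_cast_pos
  have hcov := integral_comp_mul (F.distribHaarChar_ϖu_zpow j)
    fun η => (F.χ ((F.lam l - F.lam k) * η) : ℂ) * F.density s j g h η
  rw [norm_ϖu_zpow] at hcov
  have hne : (((F.q : ℝ) ^ (-j) : ℝ) : ℂ) ≠ 0 := by exact_mod_cast (zpow_pos hq _).ne'
  have hcov' := congrArg ((((F.q : ℝ) ^ (-j) : ℝ) : ℂ) * ·) hcov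
  simp only [Complex.ofReal_inv, mul_inv_cancel_left₀ hne] at hcov'
  rw [← hcov', ← integral_const_mul, sobolevInner]
  refine integral_congr_ae ?_
  filter_upwards [(hu.scaled F j k).fourierFun_ae_eq F, (hv.scaled F j l).fourierFun_ae_eq F]
    with ξ h1 h2
  rw [h1, h2, density, weight_zpow_mul, ← rpow_neg_half_mul_self]
  set x : K := (F.ϖu ^ j : Kˣ) * ξ
  have hχ : (F.χ ((F.lam l - F.lam k) * x) : ℂ) =
      (F.χ (-(x * F.lam k)) : ℂ) * conj (F.χ (-(x * F.lam l)) : ℂ) := by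
    rw [← χ_neg_coe, neg_neg, ← Circle.coe_mul, ← AddChar.map_add_eq_mul]
    congr 2
    ring
  rw [hχ]
  simp only [map_mul, Complex.conj_ofReal, Complex.ofReal_mul]
  ring

theorem memSobolev_scaled {s : ℝ} {u : TemperedDistrib K} {g : K → ℂ}
    (hu : F.HasFourierFun u g) {j : ℤ} (hi : Integrable (F.density s j g g) (haar K)) (k : ℕ) :
    F.MemSobolev s (F.scaled u j k) := by
  have hs := hu.scaled F j k
  refine ⟨⟨_, hs⟩, ?_⟩
  have h1 := ((integrable_comp_mul_iff (F.distribHaarChar_ϖu_zpow j)).2 hi.norm).const_mul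
    ((F.q : ℝ) ^ (-j))
  refine h1.congr ?_
  filter_upwards [hs.fourierFun_ae_eq F] with ξ hξ
  set x : K := (F.ϖu ^ j : Kˣ) * ξ with hx
  have h2 : ‖(F.χ (-(x * F.lam k)) : ℂ) * g x‖ = ‖g x‖ := by
    rw [norm_mul, show ‖(F.χ (-(x * F.lam k)) : ℂ)‖ = 1 from Circle.norm_coe _, one_mul]
  have h3 : 0 ≤ (1 + ‖ξ‖ ^ 2) ^ s * ‖g x‖ ^ 2 := by positivity
  have h4 : 0 ≤ (F.q : ℝ) ^ (-(j : ℝ) / 2) := by positivity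
  rw [hξ, density_self, norm_mul, h2, Complex.norm_real, Complex.norm_real, Real.norm_of_nonneg h4,
    hx, weight_zpow_mul, ← hx, Real.norm_of_nonneg h3, ← rpow_neg_half_mul_self]
  ring

/-- Orthonormality of the translates of `u` at level `j` in terms of the Fourier transform. -/
theorem hasPeriodization_of_orthonormal {s : ℝ} {u : TemperedDistrib K} {g : K → ℂ}
    (hu : F.HasFourierFun u g) {j : ℤ}
    (h : ∀ k l : ℕ, F.sobolevInner s (F.scaled u j k) (F.scaled u j l) = if k = l then 1 else 0) :
    F.HasPeriodization s j g g 1 := by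
  simp only [F.sobolevInner_scaled hu hu] at h
  have hi : Integrable (F.density s j g g) (haar K) := by
    -- A non-integrable density would give the integral its default value 0, while the case k = l =
    -- 0 demands 1.
    by_contra hn
    have h0 := h 0 0
    simp only [sub_self, zero_mul, AddChar.map_zero_eq_one, Circle.coe_one, one_mul, if_true] at h0
    rw [integral_undef hn] at h0
    exact zero_ne_one h0
  refine F.ae_hasSum_of_integral_χ hi fun l => ?_
  have h1 := h 0 l
  rw [lam_zero, sub_zero] at h1
  rw [h1]
  exact if_congr eq_comm rfl rfl

theorem HasPeriodization.congr {s : ℝ} {j : ℤ} {g g' h h' : K → ℂ} {b : ℂ}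
    (hp : F.HasPeriodization s j g h b) (hg : g =ᵐ[haar K] g') (hh : h =ᵐ[haar K] h') :
    F.HasPeriodization s j g' h' b := by
  have hgh : ∀ᵐ x ∂(haar K), g x = g' x ∧ h x = h' x := by
    filter_upwards [hg, hh] with x h1 h2 using ⟨h1, h2⟩
  have key : ∀ k, ∀ᵐ η ∂(haarBall K), g (η + F.lam k) = g' (η + F.lam k) ∧
      h (η + F.lam k) = h' (η + F.lam k) := by
    intro k
    have h1 := (measurePreserving_add_right (haar K) (F.lam k)).quasiMeasurePreserving.ae hgh
    exact ae_restrict_of_ae h1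
  filter_upwards [hp, ae_all_iff.2 key] with η h1 h2
  refine (congrArg (HasSum · b) (funext fun k => ?_)).mp h1
  simp only [density, (h2 k).1, (h2 k).2]

theorem hasSum_of_residues {f : ℕ → ℂ} {a : Fin F.q → ℂ}
    (h : ∀ t : Fin F.q, HasSum (fun k => f (t + F.q * k)) (a t)) : HasSum f (∑ t, a t) := by
  have h1 : ∀ t : Fin F.q, HasSum (fun n => if n % F.q = t then f n else 0) (a t) := by
    intro t
    have hinj : Function.Injective fun k : ℕ => (t : ℕ) + F.q * k := fun k l hkl =>
      Nat.eq_of_mul_eq_mul_left F.q_pos (Nat.add_left_cancel hkl)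
    refine (hinj.hasSum_iff fun n hn => if_neg fun hnt => hn ⟨n / F.q, ?_⟩).1 ?_
    · simp only [← hnt, Nat.mod_add_div]
    · convert h t using 2 with k
      simp [Nat.mod_eq_of_lt t.2]
  convert hasSum_sum (s := Finset.univ) fun t _ => h1 t using 2 with n
  rw [Finset.sum_eq_single (F.digit n)]
  · simp [digit]
  · intro t _ ht
    exact if_neg fun h => ht (Fin.ext h.symm)
  · simp

/-- Multiplication by 𝔭 separates the last digit, which selects a matrix column, from the tail λ(k),
under which the filters are periodic. -/
theorem lam_add_mul {t : ℕ} (ht : t < F.q) (k : ℕ) :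
    F.ϖ * F.lam (t + F.q * k) = F.ϖ * F.lam t + F.lam k := by
  rw [ϖ_mul_lam, ϖ_mul_lam_of_lt F ht, Nat.add_mul_mod_self_left, Nat.mod_eq_of_lt ht,
    Nat.add_mul_div_left _ _ F.q_pos, Nat.div_eq_of_lt ht, zero_add]

/-- A unitary filter bank transports orthonormality from level `j + 1` to level `j`. -/
theorem HasPeriodization.filter {s : ℝ} {j : ℤ} {g h : K → ℂ} {b : ℂ} {m : Fin F.q → K → ℂ}
    (hper : ∀ r (k : ℕ) (ξ : K), m r (ξ + F.lam k) = m r ξ)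
    (hunit : ∀ᵐ ξ ∂(haarBall K), (Matrix.of fun r t : Fin F.q => m r (F.ϖ * ξ + F.ϖ * F.lam t)) ∈
      Matrix.unitaryGroup (Fin F.q) ℂ)
    (hp : F.HasPeriodization s (j + 1) g h b) (r r' : Fin F.q) :
    F.HasPeriodization s j (fun ξ => m r (F.ϖ * ξ) * g (F.ϖ * ξ))
      (fun ξ => m r' (F.ϖ * ξ) * h (F.ϖ * ξ)) (if r = r' then b else 0) := by
  have hqm : ∀ t : Fin F.q, Measure.QuasiMeasurePreserving
      (fun η => F.ϖ * η + F.ϖ * F.lam t) (haar K) (haar K) := by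
    intro t
    have h0 := F.distribHaarChar_ϖu_zpow 1
    rw [zpow_one] at h0
    exact (measurePreserving_add_right (haar K) (F.ϖ * F.lam t)).quasiMeasurePreserving.comp
      (quasiMeasurePreserving_mul h0)
  -- For η in D the point 𝔭η + 𝔭λ(t) lies in D again, and the affine map pulls null sets back to
  -- null sets.
  have h1 : ∀ t : Fin F.q, ∀ᵐ η ∂(haarBall K), HasSum (fun k => F.density s (j + 1) g h
      (F.ϖ * η + F.ϖ * F.lam t + F.lam k)) b := by
    intro t
    have h2 := (hqm t).ae ((ae_restrict_iff' measurableSet_closedBall).1 hp)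
    refine (ae_restrict_iff' measurableSet_closedBall).2 (h2.mono fun η h3 hη => h3 ?_)
    rw [mem_closedBall_zero_iff] at hη ⊢
    refine (IsUltrametricDist.norm_add_le_max _ _).trans (max_le ?_ ?_)
    · rw [norm_mul]
      exact mul_le_one₀ F.norm_ϖ_lt_one.le (norm_nonneg _) hη
    · rw [ϖ_mul_lam_of_lt F t.2]
      exact F.norm_res_le _
  filter_upwards [hunit, ae_all_iff.2 h1] with η hU h3
  -- Orthonormality of the rows r and r' of the unitary matrix.
  have h4 : ∑ t : Fin F.q, m r (F.ϖ * η + F.ϖ * F.lam t) *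
      conj (m r' (F.ϖ * η + F.ϖ * F.lam t)) * b = if r = r' then b else 0 := by
    have h5 := congrFun (congrFun (Matrix.mem_unitaryGroup_iff.1 hU) r) r'
    simp only [Matrix.mul_apply, Matrix.star_apply, Matrix.of_apply, Matrix.one_apply,
      RCLike.star_def] at h5
    rw [← Finset.sum_mul, h5, ite_mul, one_mul, zero_mul]
  rw [← h4]
  refine F.hasSum_of_residues fun t => ?_
  have h6 := (h3 t).mul_left (m r (F.ϖ * η + F.ϖ * F.lam t) *
    conj (m r' (F.ϖ * η + F.ϖ * F.lam t)))
  refine (congrArg (HasSum · _) (funext fun k => ?_)).mpr h6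
  simp only [density]
  rw [← weight_succ_mul, mul_add, lam_add_mul F t.2, ← add_assoc, hper, hper, map_mul]
  ring

end Sobolev

/-! ### Induction over the wavelet packets. -/

section Packets

variable {K : Type*} [NontriviallyNormedField K] [IsUltrametricDist K] [LocallyCompactSpace K]
  [MeasurableSpace K] [BorelSpace K] {F : LocalFieldData K} {s : ℝ}
  {α : ℤ → Fin F.q → ℕ → ℂ} {m : ℤ → Fin F.q → K → ℂ} {φ : ℤ → TemperedDistrib K}

theorem HasFourierFun.congr {u : TemperedDistrib K} {g g' : K → ℂ} (h : F.HasFourierFun u g)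
    (hg : g =ᵐ[haar K] g') : F.HasFourierFun u g' := by
  refine ⟨h.1.congr hg, fun f => ?_⟩
  rw [h.2]
  refine integral_congr_ae ?_
  filter_upwards [hg] with ξ hξ
  rw [hξ]

theorem HasFourierFun.aestronglyMeasurable {u : TemperedDistrib K} {g : K → ℂ}
    (h : F.HasFourierFun u g) : AEStronglyMeasurable g (haar K) := by
  have : ProperSpace K := ProperSpace.of_locallyCompactSpace K
  exact h.1.aestronglyMeasurable

theorem packet_zero (j : ℤ) : F.packet φ α 0 j = φ j := by
  rw [packet, dif_pos rfl]

/-- The wavelet packet `wₙ⁽ʲ⁾` has a function as Fourier transform, and its translates are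
orthonormal. -/
def IsNormalizedPacket (F : LocalFieldData K) (s : ℝ) (φ : ℤ → TemperedDistrib K)
    (α : ℤ → Fin F.q → ℕ → ℂ) (n : ℕ) (j : ℤ) : Prop :=
  F.HasFourierFun (F.packet φ α n j) (F.fourierFun (F.packet φ α n j)) ∧
    F.HasPeriodization s j (F.fourierFun (F.packet φ α n j)) (F.fourierFun (F.packet φ α n j)) 1

theorem IsNormalizedPacket.integrable {n : ℕ} {j : ℤ} (h : IsNormalizedPacket F s φ α n j) :
    Integrable (F.density s j (F.fourierFun (F.packet φ α n j))
      (F.fourierFun (F.packet φ α n j))) (haar K) :=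
  h.2.integrable F h.1.aestronglyMeasurable

theorem isNormalizedPacket_zero {m₀ : ℤ → K → ℂ} (hφ : F.IsScalingSystem s φ m₀) (j : ℤ) :
    IsNormalizedPacket F s φ α 0 j := by
  have h := F.hasFourierFun_fourierFun (hφ.mem j).1
  rw [IsNormalizedPacket, packet_zero]
  exact ⟨h, F.hasPeriodization_of_orthonormal h (hφ.orthonormal j)⟩

/-- For n ≥ 1 the packet is by definition the sum of the series. For n = 0 it is φ⁽ʲ⁾, whose
refinement equation gives it the same Fourier transform as the sum, and the transform determines the
distribution. -/
theorem hasDistSum_packet (hm : F.IsFilterBank α m)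
    (hφ : F.IsScalingSystem s φ fun j => m j F.zeroDigit) {n : ℕ} {j : ℤ}
    (h : IsNormalizedPacket F s φ α (n / F.q) (j + 1)) :
    HasDistSum (F.splitTerm (α (j + 1) (F.digit n)) (F.packet φ α (n / F.q) (j + 1)))
        (F.packet φ α n j) ∧
      F.HasFourierFun (F.packet φ α n j) (fun ξ => m (j + 1) (F.digit n) (F.ϖ * ξ) *
        F.fourierFun (F.packet φ α (n / F.q) (j + 1)) (F.ϖ * ξ)) := by
  have hmem := fun i => F.memLp_add_lam_of_integrable h.1.aestronglyMeasurable h.integrable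
    (F.lam i)
  have hloc := F.locallyIntegrable_filter_mul (hm.memLp (j + 1) (F.digit n))
    (hm.periodic (j + 1) (F.digit n)) hmem
  have hsum : HasDistSum _ (F.ofFourierFun _ hloc) := F.hasDistSum_splitTerm
    (hm.coeff (j + 1) (F.digit n)) (hm.memLp (j + 1) (F.digit n))
    (hm.periodic (j + 1) (F.digit n)) (hm.series (j + 1) (F.digit n)) h.1 hmem
  have heq : F.packet φ α n j = F.ofFourierFun _ hloc := by
    by_cases h0 : n = 0
    · subst h0
      rw [packet_zero]
      refine HasFourierFun.eq_ofFourierFun F hloc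
        ((F.hasFourierFun_fourierFun (hφ.mem j).1).congr ?_)
      filter_upwards [hφ.refinement j] with ξ hξ
      rw [hξ]
      simp only [Nat.zero_div, packet_zero, digit, Nat.zero_mod, zeroDigit]
    · rw [packet, dif_neg h0]
      exact HasDistSum.distSum_eq hsum
  rw [heq]
  exact ⟨hsum, F.hasFourierFun_ofFourierFun hloc⟩

/-- The induction runs over all levels at once, since n at level j is reduced to ⌊n/q⌋ at level j +
1. Normalization of the smaller packet supplies the local square integrability that makes the series
for n converge. -/
theorem isNormalizedPacket (hm : F.IsFilterBank α m)
    (hφ : F.IsScalingSystem s φ fun j => m j F.zeroDigit) (n : ℕ) :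
    ∀ j, IsNormalizedPacket F s φ α n j := by
  induction n using Nat.strong_induction_on with
  | _ n ih =>
  intro j
  by_cases h0 : n = 0
  · subst h0
    exact isNormalizedPacket_zero hφ j
  have h1 := ih _ (Nat.div_lt_self (Nat.pos_of_ne_zero h0) F.one_lt_q) (j + 1)
  have h2 := (hasDistSum_packet hm hφ h1).2
  have h3 := h2.fourierFun_ae_eq F
  have h4 := h1.2.filter F (hm.periodic (j + 1)) (hm.unitary (j + 1)) (F.digit n) (F.digit n)
  rw [if_pos rfl] at h4
  exact ⟨h2.congr h3.symm, h4.congr F h3.symm h3.symm⟩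

theorem hasPeriodization_packet (hm : F.IsFilterBank α m)
    (hφ : F.IsScalingSystem s φ fun j => m j F.zeroDigit) (n n' : ℕ) (j : ℤ) :
    F.HasPeriodization s j (F.fourierFun (F.packet φ α n j)) (F.fourierFun (F.packet φ α n' j))
      (if n = n' then 1 else 0) := by
  induction hN : n + n' using Nat.strong_induction_on generalizing n n' j with
  | _ N ih =>
  -- With the diagonal settled, one of n, n' is nonzero, so removing the last digits strictly lowers
  -- n + n'.
  by_cases h0 : n = n'
  · subst h0
    rw [if_pos rfl]
    exact (isNormalizedPacket hm hφ n j).2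
  have hlt : n / F.q + n' / F.q < N := by
    have h1 := Nat.div_le_self n F.q
    have h2 := Nat.div_le_self n' F.q
    rcases Nat.eq_zero_or_pos n with hn | hn
    · have := Nat.div_lt_self (show 0 < n' by omega) F.one_lt_q
      omega
    · have := Nat.div_lt_self hn F.one_lt_q
      omega
  have h1 := (ih _ hlt (n / F.q) (n' / F.q) (j + 1) rfl).filter F (hm.periodic (j + 1))
    (hm.unitary (j + 1)) (F.digit n) (F.digit n')
  have h2 : ∀ k, (fun ξ => m (j + 1) (F.digit k) (F.ϖ * ξ) *
        F.fourierFun (F.packet φ α (k / F.q) (j + 1)) (F.ϖ * ξ)) =ᵐ[haar K]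
      F.fourierFun (F.packet φ α k j) := fun k =>
    ((hasDistSum_packet hm hφ (isNormalizedPacket hm hφ (k / F.q) (j + 1))).2.fourierFun_ae_eq
      F).symm
  have h3 : (if F.digit n = F.digit n' then (if n / F.q = n' / F.q then (1 : ℂ) else 0) else 0) =
      if n = n' then 1 else 0 := by
    rw [if_neg h0]
    split_ifs with h4 h5
    · refine absurd ?_ h0
      rw [← Nat.mod_add_div n F.q, ← Nat.mod_add_div n' F.q, h5, Fin.mk.inj h4]
    · rfl
    · rfl
  rw [← h3]
  exact h1.congr F (h2 n) (h2 n')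

end Packets

end LocalFieldData

end LocalFieldWavelet

end

/-! ### The main theorem. -/

open LocalFieldWavelet in
theorem mainTheorem1 {K : Type*} [NontriviallyNormedField K] [IsUltrametricDist K]
    [LocallyCompactSpace K] [MeasurableSpace K] [BorelSpace K] (F : LocalFieldData K) (s : ℝ)
    (α : ℤ → Fin F.q → ℕ → ℂ) (filt : ℤ → Fin F.q → K → ℂ) (hfilt : F.IsFilterBank α filt)
    (φ : ℤ → TemperedDistrib K) (hφ : F.IsScalingSystem s φ (fun j => filt j F.zeroDigit)) :
    (∀ (j : ℤ) (r : Fin F.q) (ℓ : ℕ),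
      HasDistSum (F.splitTerm (α (j + 1) r) (F.packet φ α ℓ (j + 1)))
        (F.packet φ α (r + F.q * ℓ) j)) ∧
    (∀ (j : ℤ) (k n : ℕ), F.MemSobolev s (F.scaled (F.packet φ α n j) j k)) ∧
    ∀ (j : ℤ) (k l m n : ℕ),
      F.sobolevInner s (F.scaled (F.packet φ α n j) j k) (F.scaled (F.packet φ α m j) j l) =
        (if n / F.q = m / F.q then 1 else 0) * (if n % F.q = m % F.q then 1 else 0) *
          (if k = l then 1 else 0) := by
  have hnorm := LocalFieldData.isNormalizedPacket hfilt hφ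
  refine ⟨fun j r ℓ => ?_, fun j k n => ?_, fun j k l m n => ?_⟩
  · have hdiv : (r + F.q * ℓ) / F.q = ℓ := by
      rw [Nat.add_mul_div_left _ _ F.q_pos, Nat.div_eq_of_lt r.2, zero_add]
    have hdigit : F.digit (r + F.q * ℓ) = r :=
      Fin.ext (by simp [LocalFieldData.digit, Nat.mod_eq_of_lt r.2])
    have h := (LocalFieldData.hasDistSum_packet (n := r + F.q * ℓ) (j := j) hfilt hφ
      (hnorm _ (j + 1))).1
    rwa [hdiv, hdigit] at h
  · exact F.memSobolev_scaled (hnorm n j).1 (hnorm n j).integrable k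
  · have hi := F.integrable_density (hnorm n j).1.aestronglyMeasurable
      (hnorm m j).1.aestronglyMeasurable (hnorm n j).integrable (hnorm m j).integrable
    rw [F.sobolevInner_scaled (hnorm n j).1 (hnorm m j).1,
      F.integral_χ_mul_density hi (LocalFieldData.hasPeriodization_packet hfilt hφ n m j)]
    -- The periodization gives δ_{n,m}, which factors through quotient and last digit.
    have h : n = m ↔ n / F.q = m / F.q ∧ n % F.q = m % F.q := by
      refine ⟨fun h => by simp [h], fun h => ?_⟩
      rw [← Nat.mod_add_div n F.q, ← Nat.mod_add_div m F.q, h.1, h.2]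
    by_cases h1 : n / F.q = m / F.q <;> by_cases h2 : n % F.q = m % F.q <;> simp [h, h1, h2]
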